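/- A $k$-hypergraph on a finite set $V$ is a set $g\subseteq V^k$ of $k$-tuples (repeated vertices are allowed) that is invariant under permutations of the coordinates; a $k$-distinguishing class is a set of $k$-hypergraphs on $V$. For a probability distribution $p$ on $V$ put $L_p(g)=p^{k}(g)$, the probability that $k$ independent draws from $p$ form an element of $g$, and for a $k$-distinguishing class $\mathcal G$ put $\mathrm{IPM}_{\mathcal G}(p_1,p_2)=\sup_{g\in\mathcal G}|L_{p_1}(g)-L_{p_2}(g)|$ (equal to $0$ if $\mathcal G=\emptyset$). The class $\mathcal G$ has sample complexity (at most) $m(\epsilon,\delta)$, for $\epsilon,\delta\in(0,1)$, if there is an algorithm, i.e. a map that assigns to each pair $(S_1,S_2)$ of finite samples of vertices a hypergraph $g_S\in\mathcal G$, such that for all $\epsilon,\delta\in(0,1)$ and all distributions $p_1,p_2$ on $V$: if $S_1$ and $S_2$ are independent i.i.d. samples from $p_1$ and $p_2$, each of size greater than $m(\epsilon,\delta)$, then with probability at least $1-\delta$ we have $|L_{p_1}(g_S)-L_{p_2}(g_S)|>\mathrm{IPM}_{\mathcal G}(p_1,p_2)-\epsilon$. The graph VC dimension $\mathrm{gVC}(\mathcal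 G)$ is the VC dimension if $k=1$ (a $1$-hypergraph being a subset of $V$), and for $k>1$ it is $\max_{v\in V}\mathrm{gVC}(\mathcal G_v)$, where $\mathcal G_v=\{g_v: g\in\mathcal G\}$ and $g_v=\{(u_1,\dots,u_{k-1}):(v,u_1,\dots,u_{k-1})\in g\}$; the empty class has graph VC dimension $0$. Theorem. There are absolute constants $C,c>0$ such that for every $k\ge 2$ and every finite set $V$ with $|V|=n\ge 3$ there is a $k$-distinguishing class $\mathcal G_k$ on $V$ with $|\mathcal G_k|=1$ such that: (1) $\mathcal G_k$ has sample complexity $m(\epsilon,\delta)\le C\,\frac{k^2+\log(1/\delta)}{\epsilon^2}$ for all $\epsilon,\delta\in(0,1)$; (2) for every $\epsilon>0$ and every $(k-1)$-distinguishing class $\mathcal G_{k-1}$ on $V$, if $\mathrm{IPM}_{\mathcal G_{k-1}}(p_1,p_2)\ge\epsilon\cdot\mathrm{IPM}_{\mathcal G_k}(p_1,p_2)$ for all distributions $p_1,p_2$ on $V$, then $$\mathrm{gVC}(\mathcal G_{k-1})\ \ge\ c\,\frac{\epsilon^2}{k^2}\sqrt{\log n}.$$ -/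

import Mathlib

open scoped BigOperators

noncomputable section

/-- An undirected `k`-hypergraph on the vertex set `V`: a set of `k`-tuples of vertices (tuples may
repeat a vertex) that is invariant under permutations of the coordinates. -/
@[ext]
structure KHypergraph (V : Type*) (k : ℕ) where
  edges : Set (Fin k → V)
  undirected : ∀ (π : Equiv.Perm (Fin k)) (v : Fin k → V), v ∈ edges → v ∘ π ∈ edges

namespace KHypergraph

/-- The projection `g_v` of a `(k+1)`-hypergraph: the first vertex of an edge is fixed to be `v`. -/
def proj {V : Type*} {k : ℕ} (g : KHypergraph V (k + 1)) (v : V) : KHypergraph V k where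
  edges := {u | (Fin.cons v u : Fin (k + 1) → V) ∈ g.edges}
  undirected := by
    intro π u hu
    have h := g.undirected (Equiv.Perm.decomposeFin.symm (0, π)) _ hu
    have e : (Fin.cons v u : Fin (k + 1) → V) ∘ (Equiv.Perm.decomposeFin.symm (0, π)) =
        (Fin.cons v (u ∘ π) : Fin (k + 1) → V) := by
      funext i
      refine Fin.cases ?_ (fun j => ?_) i <;> simp
    simpa [e] using h

end KHypergraph

open Classical in
/-- The probability of the event `E` when the coordinates of a `k`-tuple are drawn independently
from the distribution `P` on the finite set `V`. -/
def iidProb {V : Type*} [Fintype V] {k : ℕ} (P : PMF V) (E : Set (Fin k → V)) : ℝ :=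
  ∑ v : Fin k → V, if v ∈ E then ∏ i, (P (v i)).toReal else 0

/-- The frequency of the edges of `g` under `P`. -/
def edgeFreq {V : Type*} [Fintype V] {k : ℕ} (P : PMF V) (g : KHypergraph V k) : ℝ :=
  iidProb P g.edges

/-- The integral probability metric of a class of `k`-hypergraphs. The values lie in `[0, 1]`;
for the empty class the supremum is `0`. -/
def ipm {V : Type*} [Fintype V] {k : ℕ} (G : Set (KHypergraph V k)) (p₁ p₂ : PMF V) : ℝ :=
  ⨆ g : G, |edgeFreq p₁ g.1 - edgeFreq p₂ g.1|

open Classical in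
/-- The probability of an event about a pair of independent samples, `S₁` consisting of `m₁`
independent draws from `p₁`, and `S₂` consisting of `m₂` independent draws from `p₂`. -/
def twoSampleProb {V : Type*} [Fintype V] (p₁ p₂ : PMF V) (m₁ m₂ : ℕ)
    (E : Set ((Fin m₁ → V) × (Fin m₂ → V))) : ℝ :=
  ∑ S₁ : Fin m₁ → V, ∑ S₂ : Fin m₂ → V,
    if (S₁, S₂) ∈ E then (∏ i, (p₁ (S₁ i)).toReal) * ∏ j, (p₂ (S₂ j)).toReal else 0

/-- `A`, which maps a pair of finite samples to an element of `G`, is a `G`-discriminating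
algorithm with sample complexity `m`. -/
def IsDiscriminatingAlgorithm {V : Type*} [Fintype V] {k : ℕ} (G : Set (KHypergraph V k))
    (A : ∀ m₁ m₂ : ℕ, (Fin m₁ → V) → (Fin m₂ → V) → G) (m : ℝ → ℝ → ℕ) : Prop :=
  ∀ ε δ : ℝ, 0 < ε → ε < 1 → 0 < δ → δ < 1 →
    ∀ (p₁ p₂ : PMF V) (m₁ m₂ : ℕ), m ε δ < m₁ → m ε δ < m₂ →
      1 - δ ≤ twoSampleProb p₁ p₂ m₁ m₂
        {S | ipm G p₁ p₂ - ε <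
          |edgeFreq p₁ (A m₁ m₂ S.1 S.2).1 - edgeFreq p₂ (A m₁ m₂ S.1 S.2).1|}

/-- Some `G`-discriminating algorithm has sample complexity `m`, that is, the sample complexity
of `G` is at most `m`. -/
def HasSampleComplexity {V : Type*} [Fintype V] {k : ℕ} (G : Set (KHypergraph V k))
    (m : ℝ → ℝ → ℕ) : Prop :=
  ∃ A : ∀ m₁ m₂ : ℕ, (Fin m₁ → V) → (Fin m₂ → V) → G, IsDiscriminatingAlgorithm G A m

open Classical in
/-- The VC dimension of a class of `1`-hypergraphs, which are identified with subsets of `V`. -/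
def vcDimension {V : Type*} [Fintype V] (G : Set (KHypergraph V 1)) : ℕ :=
  Finset.vcDim (Finset.univ.filter
    fun D : Finset V => ∃ g ∈ G, ∀ v : V, v ∈ D ↔ (fun _ => v) ∈ g.edges)

/-- The graph VC dimension. (The value at `k = 0` plays no role.) -/
def gVC {V : Type*} [Fintype V] : (k : ℕ) → Set (KHypergraph V k) → ℕ
  | 0, _ => 0
  | 1, G => vcDimension G
  | k + 2, G => Finset.univ.sup fun v : V => gVC (k + 1) ((fun g => g.proj v) '' G)

end

/-! A class of one hypergraph needs no samples, so (1) is free. For (2), write `k = r + 2`. The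
hypergraph comes from Shamir's secret sharing over a field with `2 ^ m` elements, `m` about `log n /
2`. Its vertices are pairs (position, share) and pairs (index, bit); an edge is `r + 1` shares of
one dealing together with one correct bit of its secret. Mixing the shares of a dealing `t` with its
correct bits gives edge frequency at least `1 / 8`; with all bits flipped it gives `0`, since `r +
1` shares determine the secret.

A hypergraph of arity `r + 1` sees too little. A hybrid argument bounds the difference of its two
frequencies through its links at `r` vertices, and `r` vertices reveal at most `r` shares, which are
consistent with every secret. Hence the links available there do not depend on the secret. By
Sauer–Shelah they leave at most `(2m + 1) ^ d` traces on the bit vertices, `d` being the graph VC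
dimension. Hoeffding's inequality and a union bound over the traces and the `(K + 2m) ^ r` lists of
positions yield a dealing whose secret correlates with none of them, unless `d` is large
(`ThresholdScheme.one_le_of_ipm_le`).

The union bound costs a term `r * log m`, which is absorbed only if `d ≥ 1`. That is the role of the
extra edges with one defect: their frequency is a multiple of `α ^ (r + 1) * β`, which is not a
function of any single frequency polynomial of degree `r + 1` (`exists_weightedFreq_eq_and_ne`), so
one hypergraph of smaller arity never suffices. The same fact settles small `n`, where the claimed
bound is at most `1`. -/

/-! ### Frequencies under weights and their push-forwards -/

open Classical in
/-- The probability of `E` under independent draws with weights `c`, in a commutative semiring. -/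
noncomputable def weightedFreq {Ω R : Type*} [Fintype Ω] [CommSemiring R] {k : ℕ} (c : Ω → R)
    (E : Set (Fin k → Ω)) : R :=
  ∑ ω : Fin k → Ω, if ω ∈ E then ∏ i, c (ω i) else 0

theorem iidProb_eq_weightedFreq {V : Type*} [Fintype V] {k : ℕ} (P : PMF V)
    (E : Set (Fin k → V)) : iidProb P E = weightedFreq (fun v => (P v).toReal) E := rfl

open Classical in
/-- The push-forward of the weights `c` along `φ`. -/
noncomputable def pushWeight {Ω V R : Type*} [Fintype Ω] [CommSemiring R] (φ : Ω → V) (c : Ω → R)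
    (v : V) : R :=
  ∑ ω, if φ ω = v then c ω else 0

theorem sum_pushWeight_mul {Ω V R : Type*} [Fintype Ω] [Fintype V] [CommSemiring R] (φ : Ω → V)
    (c : Ω → R) (F : V → R) : ∑ v, pushWeight φ c v * F v = ∑ ω, c ω * F (φ ω) := by
  classical
  simp only [pushWeight, Finset.sum_mul, ite_mul, zero_mul]
  rw [Finset.sum_comm]
  simp

theorem sum_pushWeight {Ω V R : Type*} [Fintype Ω] [Fintype V] [CommSemiring R] (φ : Ω → V)
    (c : Ω → R) : ∑ v, pushWeight φ c v = ∑ ω, c ω := by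
  simpa using sum_pushWeight_mul φ c fun _ => 1

theorem pushWeight_nonneg {Ω V : Type*} [Fintype Ω] (φ : Ω → V) {c : Ω → ℝ} (hc : ∀ ω, 0 ≤ c ω)
    (v : V) : 0 ≤ pushWeight φ c v :=
  Finset.sum_nonneg fun ω _ => by split_ifs <;> simp [hc]

theorem exists_of_pushWeight_ne_zero {Ω V R : Type*} [Fintype Ω] [CommSemiring R] {φ : Ω → V}
    {c : Ω → R} {v : V} (h : pushWeight φ c v ≠ 0) : ∃ ω, φ ω = v := by
  obtain ⟨ω, -, hω⟩ := Finset.exists_ne_zero_of_sum_ne_zero h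
  exact ⟨ω, by by_contra hne; simp [hne] at hω⟩

/-- Expanding the product of sums turns a tuple drawn from the push-forward into the image of a
tuple drawn from `c`. Frequencies on `V` can then be computed on a small index type. -/
theorem weightedFreq_pushWeight {Ω V R : Type*} [Fintype Ω] [Fintype V] [CommSemiring R] {k : ℕ}
    (φ : Ω → V) (c : Ω → R) (E : Set (Fin k → V)) :
    weightedFreq (pushWeight φ c) E = weightedFreq c {ω | φ ∘ ω ∈ E} := by
  classical
  have key : ∀ v : Fin k → V, ∏ i, pushWeight φ c (v i) =
      ∑ ω : Fin k → Ω, if φ ∘ ω = v then ∏ i, c (ω i) else 0 := by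
    intro v
    simp only [pushWeight]
    rw [Finset.prod_univ_sum, Fintype.piFinset_univ]
    refine Finset.sum_congr rfl fun ω _ => ?_
    rw [Finset.prod_ite_zero]
    simp [funext_iff]
  simp only [weightedFreq, key]
  have : ∀ v : Fin k → V, (if v ∈ E then ∑ ω : Fin k → Ω,
      (if φ ∘ ω = v then ∏ i, c (ω i) else 0) else 0) =
      ∑ ω : Fin k → Ω, if φ ∘ ω = v then (if v ∈ E then ∏ i, c (ω i) else 0) else 0 := by
    intro v
    split_ifs <;> simp
  simp only [this]
  rw [Finset.sum_comm]
  simp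

theorem exists_pmf_toReal_eq_pushWeight {Ω V : Type*} [Fintype Ω] [Fintype V] (φ : Ω → V)
    {c : Ω → ℝ} (hc : ∀ ω, 0 ≤ c ω) (h1 : ∑ ω, c ω = 1) :
    ∃ P : PMF V, ∀ v, (P v).toReal = pushWeight φ c v := by
  refine ⟨PMF.ofFintype (fun v => ENNReal.ofReal (pushWeight φ c v)) ?_, fun v => ?_⟩
  · rw [← ENNReal.ofReal_sum_of_nonneg fun v _ => pushWeight_nonneg φ hc v, sum_pushWeight, h1,
      ENNReal.ofReal_one]
  · simp [pushWeight_nonneg φ hc v]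

theorem exists_pmf_edgeFreq_eq {Ω V : Type*} [Fintype Ω] [Fintype V] (φ : Ω → V)
    {c : Ω → ℝ} (hc : ∀ ω, 0 ≤ c ω) (h1 : ∑ ω, c ω = 1) :
    ∃ P : PMF V, (∀ v, (P v).toReal = pushWeight φ c v) ∧ ∀ (k : ℕ) (g : KHypergraph V k),
      edgeFreq P g = weightedFreq c {ω | φ ∘ ω ∈ g.edges} := by
  obtain ⟨P, hP⟩ := exists_pmf_toReal_eq_pushWeight φ hc h1
  refine ⟨P, hP, fun k g => ?_⟩
  rw [edgeFreq, iidProb_eq_weightedFreq, ← weightedFreq_pushWeight]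
  congr 1
  exact funext hP

theorem weightedFreq_nonneg {Ω : Type*} [Fintype Ω] {k : ℕ} {c : Ω → ℝ} (hc : ∀ ω, 0 ≤ c ω)
    (E : Set (Fin k → Ω)) : 0 ≤ weightedFreq c E := by
  classical
  refine Finset.sum_nonneg fun ω _ => ?_
  split_ifs
  · exact Finset.prod_nonneg fun i _ => hc _
  · rfl

theorem sum_prod_eq_one {Ω : Type*} [Fintype Ω] {k : ℕ} {c : Ω → ℝ} (h1 : ∑ ω, c ω = 1) :
    ∑ ω : Fin k → Ω, ∏ i, c (ω i) = 1 := by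
  classical
  have := Finset.prod_univ_sum (fun _ : Fin k => (Finset.univ : Finset Ω)) fun _ ω => c ω
  rw [Fintype.piFinset_univ] at this
  rw [← this]
  simp [h1]

theorem weightedFreq_le_one {Ω : Type*} [Fintype Ω] {k : ℕ} {c : Ω → ℝ} (hc : ∀ ω, 0 ≤ c ω)
    (h1 : ∑ ω, c ω = 1) (E : Set (Fin k → Ω)) : weightedFreq c E ≤ 1 := by
  classical
  rw [← sum_prod_eq_one (k := k) h1]
  refine Finset.sum_le_sum fun ω _ => ?_
  split_ifs
  · rfl
  · exact Finset.prod_nonneg fun i _ => hc _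

/-! ### Edge frequencies, the metric, and classes of one hypergraph -/

theorem PMF.sum_toReal_eq_one {V : Type*} [Fintype V] (P : PMF V) : ∑ v, (P v).toReal = 1 := by
  rw [← ENNReal.toReal_sum fun v _ => P.apply_ne_top v, ← tsum_fintype (L := .unconditional _),
    P.tsum_coe, ENNReal.toReal_one]

theorem edgeFreq_nonneg {V : Type*} [Fintype V] {k : ℕ} (P : PMF V) (g : KHypergraph V k) :
    0 ≤ edgeFreq P g :=
  weightedFreq_nonneg (fun _ => ENNReal.toReal_nonneg) _

theorem edgeFreq_le_one {V : Type*} [Fintype V] {k : ℕ} (P : PMF V) (g : KHypergraph V k) :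
    edgeFreq P g ≤ 1 :=
  weightedFreq_le_one (fun _ => ENNReal.toReal_nonneg) P.sum_toReal_eq_one _

theorem ipm_le {V : Type*} [Fintype V] {k : ℕ} {G : Set (KHypergraph V k)} {p₁ p₂ : PMF V} {B : ℝ}
    (hB : 0 ≤ B) (h : ∀ g ∈ G, |edgeFreq p₁ g - edgeFreq p₂ g| ≤ B) : ipm G p₁ p₂ ≤ B :=
  Real.iSup_le (fun g => h g.1 g.2) hB

theorem ipm_le_one {V : Type*} [Fintype V] {k : ℕ} (G : Set (KHypergraph V k)) (p₁ p₂ : PMF V) :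
    ipm G p₁ p₂ ≤ 1 :=
  ipm_le zero_le_one fun g _ => abs_sub_le_iff.2
    ⟨by linarith [edgeFreq_le_one p₁ g, edgeFreq_nonneg p₂ g],
      by linarith [edgeFreq_le_one p₂ g, edgeFreq_nonneg p₁ g]⟩

theorem ipm_singleton {V : Type*} [Fintype V] {k : ℕ} (g : KHypergraph V k) (p₁ p₂ : PMF V) :
    ipm {g} p₁ p₂ = |edgeFreq p₁ g - edgeFreq p₂ g| := by
  rw [ipm, ciSup_unique]
  rfl

theorem twoSampleProb_univ {V : Type*} [Fintype V] (p₁ p₂ : PMF V) (m₁ m₂ : ℕ) :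
    twoSampleProb p₁ p₂ m₁ m₂ Set.univ = 1 := by
  simp only [twoSampleProb, Set.mem_univ, if_true, ← Finset.mul_sum,
    sum_prod_eq_one p₂.sum_toReal_eq_one, mul_one, sum_prod_eq_one p₁.sum_toReal_eq_one]

/-- A class of one hypergraph is discriminated without any samples. -/
theorem hasSampleComplexity_singleton {V : Type*} [Fintype V] {k : ℕ} (g : KHypergraph V k) :
    HasSampleComplexity {g} fun _ _ => 0 := by
  refine ⟨fun _ _ _ _ => ⟨g, rfl⟩, fun ε δ hε _ hδ _ p₁ p₂ m₁ m₂ _ _ => ?_⟩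
  have : {S : (Fin m₁ → V) × (Fin m₂ → V) | ipm {g} p₁ p₂ - ε <
      |edgeFreq p₁ g - edgeFreq p₂ g|} = Set.univ := by
    ext S
    simpa [ipm_singleton] using hε
  simp only [this, twoSampleProb_univ]
  linarith

/-! ### Links, the hybrid argument and the graph VC dimension -/

namespace KHypergraph

open Classical in
/-- The set of vertices that complete `u` to an edge. -/
noncomputable def link {V : Type*} [Fintype V] {k : ℕ} (h : KHypergraph V (k + 1)) (u : Fin k → V) :
    Finset V :=
  Finset.univ.filter fun v => (Fin.cons v u : Fin (k + 1) → V) ∈ h.edges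

theorem mem_link {V : Type*} [Fintype V] {k : ℕ} {h : KHypergraph V (k + 1)} {u : Fin k → V}
    {v : V} : v ∈ h.link u ↔ (Fin.cons v u : Fin (k + 1) → V) ∈ h.edges := by
  simp [link]

theorem cons_cons_mem_comm {V : Type*} {k : ℕ} (h : KHypergraph V (k + 2)) (u : Fin k → V)
    (x v : V) (hx : (Fin.cons x (Fin.cons v u : Fin (k + 1) → V) : Fin (k + 2) → V) ∈ h.edges) :
    (Fin.cons v (Fin.cons x u : Fin (k + 1) → V) : Fin (k + 2) → V) ∈ h.edges := by
  have := h.undirected (Equiv.swap 0 1) _ hx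
  convert this using 1
  funext i
  refine Fin.cases ?_ (fun j => Fin.cases ?_ (fun l => ?_) j) i
  · simp
  · simp
  · have h0 : (l.succ.succ : Fin (k + 2)) ≠ 0 := Fin.succ_ne_zero _
    have h1 : (l.succ.succ : Fin (k + 2)) ≠ 1 := fun h =>
      Fin.succ_ne_zero l (Fin.succ_injective _ h)
    simp [Equiv.swap_apply_of_ne_of_ne h0 h1]

/-- `proj` fixes the first coordinate and `link` leaves the first one free, so combining them
requires the symmetry of the edge set. -/
theorem link_proj {V : Type*} [Fintype V] {k : ℕ} (h : KHypergraph V (k + 2)) (u : Fin k → V)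
    (x : V) : (h.proj x).link u = h.link (Fin.cons x u) := by
  ext v
  simp only [mem_link]
  exact ⟨cons_cons_mem_comm h u x v, cons_cons_mem_comm h u v x⟩

end KHypergraph

theorem weightedFreq_proj {V : Type*} [Fintype V] {k : ℕ} (w : V → ℝ) (h : KHypergraph V (k + 1)) :
    weightedFreq w h.edges = ∑ v, w v * weightedFreq w (h.proj v).edges := by
  classical
  rw [weightedFreq, ← (Fin.consEquiv fun _ : Fin (k + 1) => V).sum_comp, Fintype.sum_prod_type]
  refine Finset.sum_congr rfl fun v _ => ?_
  simp only [weightedFreq, Finset.mul_sum]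
  refine Finset.sum_congr rfl fun u _ => ?_
  have hm : u ∈ (h.proj v).edges ↔ (Fin.cons v u : Fin (k + 1) → V) ∈ h.edges := Iff.rfl
  by_cases hv : (Fin.cons v u : Fin (k + 1) → V) ∈ h.edges <;>
    simp [Fin.consEquiv, Fin.prod_univ_succ, hm, hv]

/-- Exchanging the sums collects `f` on links. It is used with `f` the signed difference of two
distributions. -/
theorem weightedFreq_link {V : Type*} [Fintype V] {k : ℕ} (f w : V → ℝ)
    (h : KHypergraph V (k + 1)) :
    ∑ v, f v * weightedFreq w (h.proj v).edges =
      ∑ u : Fin k → V, (∏ i, w (u i)) * ∑ v ∈ h.link u, f v := by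
  classical
  simp only [weightedFreq, KHypergraph.link, Finset.mul_sum, Finset.sum_filter]
  rw [Finset.sum_comm]
  refine Finset.sum_congr rfl fun u _ => Finset.sum_congr rfl fun v _ => ?_
  have hm : u ∈ (h.proj v).edges ↔ (Fin.cons v u : Fin (k + 1) → V) ∈ h.edges := Iff.rfl
  by_cases hv : (Fin.cons v u : Fin (k + 1) → V) ∈ h.edges <;> simp [hm, hv, mul_comm]

/-- Edge frequencies under two distributions are close if the links have close weights. -/
theorem abs_weightedFreq_sub_le {V : Type*} [Fintype V] {w₁ w₂ : V → ℝ} (h₁ : ∀ v, 0 ≤ w₁ v)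
    (h₂ : ∀ v, 0 ≤ w₂ v) (s₁ : ∑ v, w₁ v = 1) (s₂ : ∑ v, w₂ v = 1) {B : ℝ} :
    ∀ {k : ℕ} (h : KHypergraph V (k + 1)),
      (∀ u : Fin k → V, (∀ i, w₁ (u i) ≠ 0 ∨ w₂ (u i) ≠ 0) →
        |∑ v ∈ h.link u, (w₁ v - w₂ v)| ≤ B) →
      |weightedFreq w₁ h.edges - weightedFreq w₂ h.edges| ≤ (k + 1) * B := by
  have first : ∀ {k : ℕ} (h : KHypergraph V (k + 1)),
      (∀ u : Fin k → V, (∀ i, w₁ (u i) ≠ 0 ∨ w₂ (u i) ≠ 0) →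
        |∑ v ∈ h.link u, (w₁ v - w₂ v)| ≤ B) →
      |∑ v, (w₁ v - w₂ v) * weightedFreq w₂ (h.proj v).edges| ≤ B := by
    intro k h hu
    rw [weightedFreq_link]
    calc |∑ u : Fin k → V, (∏ i, w₂ (u i)) * ∑ v ∈ h.link u, (w₁ v - w₂ v)|
        ≤ ∑ u : Fin k → V, |(∏ i, w₂ (u i)) * ∑ v ∈ h.link u, (w₁ v - w₂ v)| :=
          Finset.abs_sum_le_sum_abs _ _
      _ ≤ ∑ u : Fin k → V, (∏ i, w₂ (u i)) * B := by
          refine Finset.sum_le_sum fun u _ => ?_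
          have h0 : 0 ≤ ∏ i, w₂ (u i) := Finset.prod_nonneg fun i _ => h₂ _
          rw [abs_mul, abs_of_nonneg h0]
          by_cases hz : ∏ i, w₂ (u i) = 0
          · simp [hz]
          · refine mul_le_mul_of_nonneg_left (hu u fun i => Or.inr fun hi => hz ?_) h0
            exact Finset.prod_eq_zero (Finset.mem_univ i) hi
      _ = B := by rw [← Finset.sum_mul, sum_prod_eq_one s₂, one_mul]
  intro k
  induction k with
  | zero =>
    intro h hu
    -- At arity `0` the frequency is an empty product, independent of the weights.
    have e : ∀ v, weightedFreq w₁ (h.proj v).edges = weightedFreq w₂ (h.proj v).edges := by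
      intro v
      simp [weightedFreq]
    rw [weightedFreq_proj, weightedFreq_proj w₂, ← Finset.sum_sub_distrib]
    simp only [e, ← sub_mul]
    simpa using first h hu
  | succ k ih =>
    intro h hu
    -- Hybrid step: only the distribution of the first draw changes in the first sum; the second sum
    -- is left to the induction, with the first vertex drawn from `w₁`.
    have split : weightedFreq w₁ h.edges - weightedFreq w₂ h.edges =
        ∑ v, (w₁ v - w₂ v) * weightedFreq w₂ (h.proj v).edges +
          ∑ v, w₁ v * (weightedFreq w₁ (h.proj v).edges - weightedFreq w₂ (h.proj v).edges) := by
      rw [weightedFreq_proj, weightedFreq_proj w₂, ← Finset.sum_sub_distrib,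
        ← Finset.sum_add_distrib]
      refine Finset.sum_congr rfl fun v _ => ?_
      ring
    have second : |∑ v, w₁ v *
        (weightedFreq w₁ (h.proj v).edges - weightedFreq w₂ (h.proj v).edges)| ≤ (k + 1) * B := by
      calc _ ≤ ∑ v, |w₁ v *
              (weightedFreq w₁ (h.proj v).edges - weightedFreq w₂ (h.proj v).edges)| :=
            Finset.abs_sum_le_sum_abs _ _
        _ ≤ ∑ v, w₁ v * ((k + 1) * B) := by
            refine Finset.sum_le_sum fun v _ => ?_
            rw [abs_mul, abs_of_nonneg (h₁ v)]
            by_cases hz : w₁ v = 0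
            · simp [hz]
            · refine mul_le_mul_of_nonneg_left (ih _ fun u hu' => ?_) (h₁ v)
              rw [KHypergraph.link_proj]
              exact hu _ fun i => Fin.cases (by simp [hz]) (fun j => by simpa using hu' j) i
        _ = (k + 1) * B := by rw [← Finset.sum_mul, s₁, one_mul]
    rw [split]
    refine (abs_add_le _ _).trans ?_
    push_cast
    linarith [first h hu]

-- Projecting successively along the entries of `u` leaves exactly the links at `u`, and the graph
-- VC dimension is a maximum over all such choices.
open Classical in
theorem vcDim_links_le_gVC {V : Type*} [Fintype V] : ∀ {k : ℕ} (G : Set (KHypergraph V (k + 1)))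
    (u : Fin k → V),
    Finset.vcDim (Finset.univ.filter fun D : Finset V => ∃ h ∈ G, h.link u = D) ≤
      gVC (k + 1) G := by
  intro k
  induction k with
  | zero =>
    intro G u
    rw [gVC, vcDimension]
    refine le_of_eq ?_
    congr 1
    ext D
    simp only [Finset.mem_filter, Finset.mem_univ, true_and]
    refine exists_congr fun h => and_congr_right fun _ => ?_
    have hc : ∀ v : V, (Fin.cons v u : Fin 1 → V) = fun _ => v := fun v => by
      funext i
      exact Fin.cases rfl (fun j => j.elim0) i
    constructor
    · rintro rfl v
      rw [KHypergraph.mem_link, hc]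
    · intro hD
      ext v
      rw [KHypergraph.mem_link, hc, hD]
  | succ k ih =>
    intro G u
    have step := ih ((fun g => g.proj (u 0)) '' G) (Fin.tail u)
    rw [gVC]
    refine le_trans ?_ (Finset.le_sup (f := fun v : V => gVC (k + 1) ((fun g => g.proj v) '' G))
      (Finset.mem_univ (u 0)))
    refine le_trans (le_of_eq ?_) step
    congr 1
    ext D
    simp [KHypergraph.link_proj, Fin.cons_self_tail]

/-! ### Counting tools: Sauer–Shelah and Hoeffding -/

theorem sum_choose_le_pow (N d : ℕ) : ∑ i ∈ Finset.Iic d, N.choose i ≤ (N + 1) ^ d := by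
  induction d with
  | zero =>
    have : Finset.Iic 0 = {0} := rfl
    simp [this]
  | succ d ih =>
    have : Finset.Iic (d + 1) = insert (d + 1) (Finset.Iic d) := by
      ext i
      simp
      omega
    rw [this, Finset.sum_insert (by simp)]
    have h1 : N.choose (d + 1) ≤ N * (N + 1) ^ d :=
      (Nat.choose_le_pow _ _).trans (by
        rw [pow_succ']
        exact Nat.mul_le_mul_left _ (Nat.pow_le_pow_left (Nat.le_succ N) d))
    calc _ ≤ N * (N + 1) ^ d + (N + 1) ^ d := add_le_add h1 ih
      _ = (N + 1) ^ (d + 1) := by ring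

open Classical in
/-- The Sauer–Shelah bound for the traces of a family on the image of an injection. -/
theorem card_traces_le {V Y : Type*} [Fintype V] [Fintype Y] (𝒜 : Finset (Finset V)) (ψ : Y ↪ V) :
    (𝒜.image fun D => Finset.univ.filter fun y => ψ y ∈ D).card ≤
      (Fintype.card Y + 1) ^ 𝒜.vcDim := by
  set ℬ := 𝒜.image fun D => Finset.univ.filter fun y => ψ y ∈ D
  -- The image under `ψ` of a set shattered by the traces is shattered by the family itself.
  have hvc : ℬ.vcDim ≤ 𝒜.vcDim := by
    refine Finset.sup_le fun s hs => ?_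
    have hs' : ℬ.Shatters s := by simpa using hs
    have : 𝒜.Shatters (s.map ψ) := by
      intro t ht
      obtain ⟨b, hb, hbt⟩ := hs' (t := s.filter fun y => ψ y ∈ t) (Finset.filter_subset _ _)
      obtain ⟨D, hD, rfl⟩ := Finset.mem_image.1 hb
      refine ⟨D, hD, ?_⟩
      ext v
      constructor
      · intro hv
        obtain ⟨hv1, hv2⟩ := Finset.mem_inter.1 hv
        obtain ⟨y, hy, rfl⟩ := Finset.mem_map.1 hv1
        have : y ∈ s ∩ Finset.univ.filter fun y => ψ y ∈ D := by simp [hy, hv2]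
        rw [hbt] at this
        exact (Finset.mem_filter.1 this).2
      · intro hv
        obtain ⟨y, hy, rfl⟩ := Finset.mem_map.1 (ht hv)
        have : y ∈ s.filter fun y => ψ y ∈ t := by simp [hy, hv]
        rw [← hbt] at this
        simp only [Finset.mem_inter, Finset.mem_filter, Finset.mem_univ, true_and] at this
        simp [hy, this.2]
    simpa using this.card_le_vcDim
  calc ℬ.card ≤ ℬ.shatterer.card := Finset.card_le_card_shatterer ℬ
    _ ≤ ∑ i ∈ Finset.Iic ℬ.vcDim, (Fintype.card Y).choose i :=
      Finset.card_shatterer_le_sum_vcDim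
    _ ≤ (Fintype.card Y + 1) ^ ℬ.vcDim := sum_choose_le_pow _ _
    _ ≤ (Fintype.card Y + 1) ^ 𝒜.vcDim := Nat.pow_le_pow_right (Nat.succ_pos _) hvc

/-- The sign `1` of `true` and `-1` of `false`. -/
def boolSign (b : Bool) : ℝ := if b then 1 else -1

/-- Independent signs factor the exponential moment into hyperbolic cosines, and `cosh x ≤ exp (x ^
2 / 2)`. -/
theorem sum_exp_signed_sum_le {m : ℕ} {a : Fin m → ℝ} (ha : ∀ i, |a i| ≤ 1) (l : ℝ) :
    ∑ σ : Fin m → Bool, Real.exp (l * ∑ i, boolSign (σ i) * a i) ≤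
      2 ^ m * Real.exp (l ^ 2 * m / 2) := by
  have h1 : ∑ σ : Fin m → Bool, Real.exp (l * ∑ i, boolSign (σ i) * a i) =
      ∏ i, (2 * Real.cosh (l * a i)) := by
    have := Finset.prod_univ_sum (fun _ : Fin m => (Finset.univ : Finset Bool))
      fun i b => Real.exp (l * (boolSign b * a i))
    rw [Fintype.piFinset_univ] at this
    simp only [Finset.mul_sum, Real.exp_sum]
    rw [← this]
    refine Finset.prod_congr rfl fun i _ => ?_
    rw [Real.cosh_eq]
    simp [boolSign]
    ring
  rw [h1]
  calc ∏ i, (2 * Real.cosh (l * a i)) ≤ ∏ _i : Fin m, (2 * Real.exp (l ^ 2 / 2)) := by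
        refine Finset.prod_le_prod (fun i _ => by positivity) fun i _ => ?_
        have h2 : (l * a i) ^ 2 ≤ l ^ 2 := by
          rw [mul_pow]
          exact mul_le_of_le_one_right (sq_nonneg l) ((sq_le_one_iff_abs_le_one _).2 (ha i))
        have := (Real.cosh_le_exp_half_sq (l * a i)).trans
          (Real.exp_le_exp.2 (by linarith : (l * a i) ^ 2 / 2 ≤ l ^ 2 / 2))
        linarith
    _ = 2 ^ m * Real.exp (l ^ 2 * m / 2) := by
        rw [Finset.prod_const, mul_pow, Finset.card_univ, Fintype.card_fin, ← Real.exp_nat_mul]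
        congr 2
        ring

open Classical in
/-- Hoeffding's inequality for signed sums. -/
theorem card_signed_sum_gt_le {m : ℕ} {a : Fin m → ℝ} (ha : ∀ i, |a i| ≤ 1) {η : ℝ} (hη : 0 < η) :
    ((Finset.univ.filter fun σ : Fin m → Bool =>
      η * m < |∑ i, boolSign (σ i) * a i|).card : ℝ) ≤ 2 ^ m * (2 * Real.exp (-(η ^ 2 * m / 2))) := by
  -- Chernoff's bound with the optimal parameter `η`, one exponential for each tail.
  have key : ∀ σ : Fin m → Bool, (if η * m < |∑ i, boolSign (σ i) * a i| then (1 : ℝ) else 0) ≤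
      Real.exp (-(η ^ 2 * m)) * (Real.exp (η * ∑ i, boolSign (σ i) * a i) +
        Real.exp (-η * ∑ i, boolSign (σ i) * a i)) := by
    intro σ
    set S := ∑ i, boolSign (σ i) * a i
    rw [mul_add, ← Real.exp_add, ← Real.exp_add]
    split_ifs with h
    · rcases lt_abs.1 h with h | h
      · have : 1 ≤ Real.exp (-(η ^ 2 * m) + η * S) := Real.one_le_exp (by nlinarith)
        linarith [Real.exp_pos (-(η ^ 2 * m) + -η * S)]
      · have : 1 ≤ Real.exp (-(η ^ 2 * m) + -η * S) := Real.one_le_exp (by nlinarith)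
        linarith [Real.exp_pos (-(η ^ 2 * m) + η * S)]
    · positivity
  calc _ = ∑ σ : Fin m → Bool, (if η * m < |∑ i, boolSign (σ i) * a i| then (1 : ℝ) else 0) := by
        simp
    _ ≤ _ := Finset.sum_le_sum fun σ _ => key σ
    _ ≤ Real.exp (-(η ^ 2 * m)) * (2 ^ m * Real.exp (η ^ 2 * m / 2) +
          2 ^ m * Real.exp (η ^ 2 * m / 2)) := by
        rw [← Finset.mul_sum, Finset.sum_add_distrib]
        have h2 := sum_exp_signed_sum_le ha (-η)
        rw [neg_sq] at h2
        exact mul_le_mul_of_nonneg_left (add_le_add (sum_exp_signed_sum_le ha η) h2)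
          (Real.exp_pos _).le
    _ = 2 ^ m * (2 * (Real.exp (-(η ^ 2 * m)) * Real.exp (η ^ 2 * m / 2))) := by ring
    _ = _ := by
        rw [← Real.exp_add]
        congr 3
        ring

/-! ### Secret sharing and uncorrelated secrets -/

/-- A threshold scheme: `share t` and `secret t` are the shares and the secret of the dealing `t`;
any `r + 1` shares determine the secret, and any `r` of them are consistent with every secret, in a
uniform way. -/
structure ThresholdScheme (T F : Type*) [AddGroup F] (K r : ℕ) where
  share : T → Fin K → F
  secret : T → F
  secret_eq : ∀ (t t' : T) (J : Finset (Fin K)), r + 1 ≤ J.card →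
    (∀ j ∈ J, share t j = share t' j) → secret t = secret t'
  shift : Finset (Fin K) → F → Equiv.Perm T
  secret_shift : ∀ (J : Finset (Fin K)), J.card ≤ r → ∀ s t, secret (shift J s t) = secret t + s
  share_shift : ∀ (J : Finset (Fin K)), J.card ≤ r → ∀ s t, ∀ j ∈ J,
    share (shift J s t) j = share t j

open Polynomial in
/-- Shamir's scheme: the shares are the values of a polynomial of degree at most `r` at points other
than zero, and the secret is the value at zero. -/
theorem exists_thresholdScheme (F : Type) [Field F] [Fintype F] {K r : ℕ}
    (hK : K < Fintype.card F) :
    ∃ (T : Type) (_ : Fintype T), Nonempty T ∧ Nonempty (ThresholdScheme T F K r) := by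
  classical
  have hcard : Fintype.card (Fin K) ≤ Fintype.card Fˣ := by
    rw [Fintype.card_units, Fintype.card_fin]
    omega
  obtain ⟨x⟩ := Function.Embedding.nonempty_of_card_le hcard
  -- Adding `s • w J` to a polynomial adds `s` to its value at zero and keeps its values at the
  -- points of `J`.
  let w : Finset (Fin K) → F[X] := fun J => ∏ j ∈ J, (1 - C ((x j : F)⁻¹) * X)
  have hw0 : ∀ J, (w J).eval 0 = 1 := fun J => by simp [w, eval_prod]
  have hwj : ∀ J, ∀ j ∈ J, (w J).eval (x j : F) = 0 := fun J j hj => by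
    rw [eval_prod]
    exact Finset.prod_eq_zero hj (by simp)
  have hdeg : ∀ J : Finset (Fin K), J.card ≤ r → w J ∈ degreeLT F (r + 1) := fun J hJ => by
    rw [mem_degreeLT]
    refine lt_of_le_of_lt (degree_prod_le _ _) ?_
    have h1 : ∀ j ∈ J, (1 - C ((x j : F)⁻¹) * X).degree ≤ 1 := fun j _ => by
      refine (degree_sub_le _ _).trans (max_le (degree_one_le.trans zero_le_one) ?_)
      exact degree_C_mul_X_le _
    refine lt_of_le_of_lt (Finset.sum_le_sum h1) ?_
    simp only [Finset.sum_const, nsmul_eq_mul, mul_one]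
    exact_mod_cast Nat.lt_succ_of_le hJ
  let T := degreeLT F (r + 1)
  have : Finite T := Finite.of_equiv _ (degreeLTEquiv F (r + 1)).symm.toEquiv
  refine ⟨T, Fintype.ofFinite T, ⟨0⟩, ⟨?_⟩⟩
  exact
    { share := fun t j => (t : F[X]).eval (x j : F)
      secret := fun t => (t : F[X]).eval 0
      secret_eq := by
        intro t t' J hJ h
        have hinj : Set.InjOn (fun j => (x j : F)) (J : Set (Fin K)) := fun i _ j _ hij =>
          x.injective (Units.ext hij)
        have hlt : ∀ t : T, (t : F[X]).degree < J.card := fun t =>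
          lt_of_lt_of_le (mem_degreeLT.1 t.2) (by exact_mod_cast hJ)
        rw [eq_of_degrees_lt_of_eval_index_eq J hinj (hlt t) (hlt t') h]
      -- Beyond `r` positions `w J` may have too large a degree; the identity is a dummy value
      -- there.
      shift := fun J s => if h : J.card ≤ r then Equiv.addRight (s • (⟨w J, hdeg J h⟩ : T)) else 1
      secret_shift := by
        intro J hJ s t
        simp [hJ, hw0]
      share_shift := by
        intro J hJ s t j hj
        simp [hJ, hwj J j hj] }

open Classical in
/-- Union bound: if every family in a list depends on few shares only, then for some dealing the
bits of the secret correlate with no member of the families. -/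
theorem ThresholdScheme.exists_uncorrelated {T F I : Type*} [Fintype T] [Nonempty T] [Fintype I]
    [AddGroup F] {K r m : ℕ} (A : ThresholdScheme T F K r) (bits : F ≃ (Fin m → Bool))
    (J : I → Finset (Fin K)) (hJ : ∀ i, (J i).card ≤ r)
    (𝒟 : I → T → Finset (Finset (Fin m × Bool))) (M : ℝ) (hM : ∀ i t, ((𝒟 i t).card : ℝ) ≤ M)
    (h𝒟 : ∀ i t t', (∀ j ∈ J i, A.share t j = A.share t' j) → 𝒟 i t = 𝒟 i t') {η : ℝ}
    (hη : 0 < η) (hsmall : Fintype.card I * (M * (2 * Real.exp (-(η ^ 2 * m / 2)))) < 1) :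
    ∃ t, ∀ i, ∀ D ∈ 𝒟 i t,
      |∑ y, boolSign (bits (A.secret t) y) *
        ((if (y, true) ∈ D then 1 else 0) - (if (y, false) ∈ D then 1 else 0))| ≤ η * m := by
  by_contra! hbad
  let : Fintype F := Fintype.ofEquiv _ bits.symm
  set corr : (Fin m → Bool) → Finset (Fin m × Bool) → ℝ := fun σ D =>
    |∑ y, boolSign (σ y) * ((if (y, true) ∈ D then 1 else 0) - (if (y, false) ∈ D then 1 else 0))|
  set β : ℝ := 2 * Real.exp (-(η ^ 2 * m / 2))
  let bad : I → Finset T := fun i =>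
    Finset.univ.filter fun t => ∃ D ∈ 𝒟 i t, η * m < corr (bits (A.secret t)) D
  have hcardF : (Fintype.card F : ℝ) = 2 ^ m := by
    rw [Fintype.card_congr bits]
    simp
  -- Along the shifts of `t` that keep the shares in `J i`, the family is fixed while the secret
  -- runs over all bit strings, so Hoeffding's inequality applies to each of at most `M` fixed sets.
  have hfib : ∀ i t, ((Finset.univ.filter fun s : F =>
      A.shift (J i) s t ∈ bad i).card : ℝ) ≤ 2 ^ m * (M * β) := by
    intro i t
    have hsub : (Finset.univ.filter fun s : F => A.shift (J i) s t ∈ bad i).card ≤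
        ((𝒟 i t).biUnion fun D => Finset.univ.filter fun σ => η * m < corr σ D).card := by
      refine Finset.card_le_card_of_injOn (fun s => bits (A.secret t + s)) ?_ ?_
      · intro s hs
        have hs' := (Finset.mem_filter.1 (Finset.mem_filter.1 hs).2).2
        obtain ⟨D, hD, hc⟩ := hs'
        rw [A.secret_shift _ (hJ i)] at hc
        rw [h𝒟 i _ t fun j hj => A.share_shift _ (hJ i) s t j hj] at hD
        simp only [Finset.coe_biUnion, Set.mem_iUnion]
        exact ⟨D, hD, by simpa using hc⟩
      · intro s _ s' _ h
        exact add_left_cancel (bits.injective h)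
    have hD : ∀ D ∈ 𝒟 i t, (((Finset.univ.filter fun σ => η * m < corr σ D).card : ℕ) : ℝ) ≤
        2 ^ m * β := fun D _ => card_signed_sum_gt_le (fun y => by split_ifs <;> simp) hη
    calc ((Finset.univ.filter fun s : F => A.shift (J i) s t ∈ bad i).card : ℝ)
        ≤ (∑ D ∈ 𝒟 i t, (Finset.univ.filter fun σ => η * m < corr σ D).card : ℕ) := by
          exact_mod_cast hsub.trans Finset.card_biUnion_le
      _ ≤ ∑ D ∈ 𝒟 i t, 2 ^ m * β := by
          push_cast
          exact Finset.sum_le_sum hD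
      _ = (𝒟 i t).card * (2 ^ m * β) := by rw [Finset.sum_const, nsmul_eq_mul]
      _ ≤ M * (2 ^ m * β) := mul_le_mul_of_nonneg_right (hM i t) (by positivity)
      _ = 2 ^ m * (M * β) := by ring
  have hbadcard : ∀ i, ((bad i).card : ℝ) ≤ Fintype.card T * (M * β) := by
    intro i
    have hshift : ∀ s : F, (Finset.univ.filter fun t => A.shift (J i) s t ∈ bad i).card =
        (bad i).card := fun s =>
      Finset.card_equiv (A.shift (J i) s) fun t => by simp
    -- Every shift permutes the dealings, so averaging over shifts carries the bound from the orbits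
    -- to all dealings.
    have hdouble : ∑ s : F, ((Finset.univ.filter fun t => A.shift (J i) s t ∈ bad i).card : ℝ) =
        ∑ t : T, ((Finset.univ.filter fun s : F => A.shift (J i) s t ∈ bad i).card : ℝ) := by
      simp only [Finset.card_filter, Nat.cast_sum]
      exact Finset.sum_comm
    have h1 : (2 : ℝ) ^ m * (bad i).card ≤ Fintype.card T * (2 ^ m * (M * β)) := by
      calc (2 : ℝ) ^ m * (bad i).card =
            ∑ s : F, ((Finset.univ.filter fun t => A.shift (J i) s t ∈ bad i).card : ℝ) := by
            simp only [hshift, Finset.sum_const, Finset.card_univ, nsmul_eq_mul, hcardF]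
        _ ≤ ∑ t : T, 2 ^ m * (M * β) := by
            rw [hdouble]
            exact Finset.sum_le_sum fun t _ => hfib i t
        _ = _ := by rw [Finset.sum_const, Finset.card_univ, nsmul_eq_mul]
    have h2 : (0 : ℝ) < 2 ^ m := by positivity
    refine le_of_mul_le_mul_left ?_ h2
    linarith
  have hcover : (Fintype.card T : ℝ) ≤ ∑ i, ((bad i).card : ℝ) := by
    have : (Finset.univ : Finset T) ⊆ Finset.univ.biUnion bad := fun t _ => by
      obtain ⟨i, D, hD, hc⟩ := hbad t
      exact Finset.mem_biUnion.2 ⟨i, Finset.mem_univ i, Finset.mem_filter.2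
        ⟨Finset.mem_univ t, D, hD, hc⟩⟩
    exact_mod_cast (Finset.card_le_card this).trans Finset.card_biUnion_le
  have hT : (0 : ℝ) < Fintype.card T := by exact_mod_cast Fintype.card_pos
  have := hcover.trans (Finset.sum_le_sum fun i _ => hbadcard i)
  rw [Finset.sum_const, Finset.card_univ, nsmul_eq_mul] at this
  nlinarith

/-! ### Frequency polynomials in three weights -/

theorem map_weightedFreq {Ω R S : Type*} [Fintype Ω] [CommSemiring R] [CommSemiring S] {k : ℕ}
    (f : R →+* S) (c : Ω → R) (E : Set (Fin k → Ω)) :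
    f (weightedFreq c E) = weightedFreq (fun ω => f (c ω)) E := by
  classical
  simp only [weightedFreq, map_sum]
  refine Finset.sum_congr rfl fun ω _ => ?_
  split_ifs <;> simp

theorem weightedFreq_mul_left {Ω R : Type*} [Fintype Ω] [CommSemiring R] {k : ℕ} (l : R)
    (c : Ω → R) (E : Set (Fin k → Ω)) :
    weightedFreq (fun ω => l * c ω) E = l ^ k * weightedFreq c E := by
  classical
  simp only [weightedFreq, Finset.mul_sum]
  refine Finset.sum_congr rfl fun ω _ => ?_
  split_ifs <;> simp [Finset.prod_mul_distrib]

open Polynomial in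
theorem eval_weightedFreq_fin_three {k : ℕ} (N : Set (Fin k → Fin 3)) (x : ℝ) (p q s : ℝ[X]) :
    (weightedFreq ![p, q, s] N).eval x = weightedFreq ![p.eval x, q.eval x, s.eval x] N := by
  rw [← coe_evalRingHom, map_weightedFreq]
  congr 1
  funext i
  fin_cases i <;> rfl

theorem weightedFreq_fin_three_mul {k : ℕ} (N : Set (Fin k → Fin 3)) (l a b c : ℝ) :
    weightedFreq ![l * a, l * b, l * c] N = l ^ k * weightedFreq ![a, b, c] N := by
  rw [← weightedFreq_mul_left]
  congr 1
  funext i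
  fin_cases i <;> rfl

open Polynomial in
theorem natDegree_weightedFreq_le {Ω : Type*} [Fintype Ω] {k : ℕ} (c : Ω → ℝ[X])
    (hc : ∀ ω, (c ω).natDegree ≤ 1) (E : Set (Fin k → Ω)) : (weightedFreq c E).natDegree ≤ k := by
  classical
  refine natDegree_sum_le_of_forall_le _ _ fun ω _ => ?_
  split_ifs
  · refine (natDegree_prod_le _ _).trans ((Finset.sum_le_sum fun i _ => hc (ω i)).trans ?_)
    simp
  · simp

open Polynomial in
/-- A frequency polynomial of degree `r` in three weights that is constant along the curves
`α ^ r * β = s` is constant. -/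
theorem weightedFreq_eq_const {r : ℕ} (N : Set (Fin r → Fin 3)) {s₀ : ℝ} (hs₀ : 0 < s₀)
    (H : ∀ s ∈ Set.Ioo 0 s₀, ∃ q, ∀ α ∈ Set.Icc (1 / 4 : ℝ) (1 / 2),
      weightedFreq ![α, s / α ^ r, 1 - α - s / α ^ r] N = q) :
    ∃ q : ℝ, ∀ α β : ℝ, α ≠ 0 → weightedFreq ![α, β, 1 - α - β] N = q := by
  -- Homogeneity of degree `r` clears the denominators `α ^ r`.
  have scale : ∀ α s : ℝ, α ≠ 0 → weightedFreq ![α ^ (r + 1), s, α ^ r - α ^ (r + 1) - s] N =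
      (α ^ r) ^ r * weightedFreq ![α, s / α ^ r, 1 - α - s / α ^ r] N := by
    intro α s hα
    rw [← weightedFreq_fin_three_mul]
    have : α ^ r ≠ 0 := pow_ne_zero _ hα
    congr 2
    · congr 1
      · field_simp
      · congr 1
        rw [pow_succ]
        field_simp
  -- For fixed `s` both sides are polynomials in `α` that agree on an interval; `α = 1` identifies
  -- the constant.
  have step1 : ∀ s ∈ Set.Ioo 0 s₀, ∀ α : ℝ,
      weightedFreq ![α ^ (r + 1), s, α ^ r - α ^ (r + 1) - s] N =
        (α ^ r) ^ r * weightedFreq ![1, s, -s] N := by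
    intro s hs
    obtain ⟨q, hq⟩ := H s hs
    have hpoly : weightedFreq ![X ^ (r + 1), C s, X ^ r - X ^ (r + 1) - C s] N =
        C q * (X ^ r) ^ r := by
      refine eq_of_infinite_eval_eq _ _
        ((Set.Icc_infinite (by norm_num : (1 / 4 : ℝ) < 1 / 2)).mono fun α hα => ?_)
      have hα0 : α ≠ 0 := by
        have := hα.1
        intro h
        norm_num [h] at this
      have := scale α s hα0
      rw [hq α hα] at this
      simp only [Set.mem_ofPred_eq, eval_weightedFreq_fin_three]
      simpa [mul_comm] using this
    have heval : ∀ α : ℝ, weightedFreq ![α ^ (r + 1), s, α ^ r - α ^ (r + 1) - s] N =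
        q * (α ^ r) ^ r := by
      intro α
      have := congrArg (eval α) hpoly
      rw [eval_weightedFreq_fin_three] at this
      simpa using this
    have h1 : weightedFreq ![1, s, -s] N = q := by simpa using heval 1
    intro α
    rw [heval, h1, mul_comm]
  -- The same extension, now in the variable `s`.
  have step2 : ∀ s α : ℝ, weightedFreq ![α ^ (r + 1), s, α ^ r - α ^ (r + 1) - s] N =
      (α ^ r) ^ r * weightedFreq ![1, s, -s] N := by
    intro s α
    have hpoly : weightedFreq ![C (α ^ (r + 1)), X, C (α ^ r - α ^ (r + 1)) - X] N =
        C ((α ^ r) ^ r) * weightedFreq ![1, X, -X] N := by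
      refine eq_of_infinite_eval_eq _ _ ((Set.Ioo_infinite hs₀).mono fun s hs => ?_)
      have := step1 s hs α
      simp only [Set.mem_ofPred_eq, eval_mul, eval_weightedFreq_fin_three]
      simpa using this
    have := congrArg (eval s) hpoly
    rw [eval_mul, eval_weightedFreq_fin_three, eval_weightedFreq_fin_three] at this
    simpa using this
  have step3 : ∀ α β : ℝ, α ≠ 0 → weightedFreq ![α, β, 1 - α - β] N =
      (weightedFreq ![1, X, -X] N : ℝ[X]).eval (α ^ r * β) := by
    intro α β hα
    have hα' : α ^ r ≠ 0 := pow_ne_zero _ hα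
    have h1 := scale α (α ^ r * β) hα
    rw [step2, mul_div_cancel_left₀ _ hα'] at h1
    rw [eval_weightedFreq_fin_three]
    simpa using (mul_left_cancel₀ (pow_ne_zero r hα') h1).symm
  -- On the diagonal `α = β` a one-variable polynomial in `α ^ (r + 1)` equals a polynomial of
  -- degree at most `r`, so it is constant.
  have hcomp : (weightedFreq ![1, X, -X] N : ℝ[X]).comp (X ^ (r + 1)) =
      weightedFreq ![X, X, 1 - X - X] N := by
    refine eq_of_infinite_eval_eq _ _ ((Set.Ioi_infinite (0 : ℝ)).mono fun x hx => ?_)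
    have := step3 x x (ne_of_gt hx)
    rw [Set.mem_ofPred_eq, eval_comp, eval_pow, eval_X, pow_succ, ← this,
      eval_weightedFreq_fin_three]
    simp
  have hdeg : (weightedFreq ![1, X, -X] N : ℝ[X]).natDegree = 0 := by
    have h1 : (weightedFreq ![X, X, 1 - X - X] N : ℝ[X]).natDegree ≤ r := by
      refine natDegree_weightedFreq_le _ (fun i => ?_) N
      fin_cases i
      · exact natDegree_X_le
      · exact natDegree_X_le
      · exact (natDegree_sub_le _ _).trans (max_le ((natDegree_sub_le _ _).trans
          (max_le (by simp) natDegree_X_le)) natDegree_X_le)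
    rw [← hcomp, natDegree_comp, natDegree_X_pow] at h1
    by_contra h
    nlinarith [Nat.pos_of_ne_zero h]
  rw [natDegree_eq_zero] at hdeg
  obtain ⟨q, hq⟩ := hdeg
  exact ⟨q, fun α β hα => by rw [step3 α β hα, ← hq, eval_C]⟩

theorem continuous_weightedFreq {Ω : Type*} [Fintype Ω] {k : ℕ} (E : Set (Fin k → Ω)) :
    Continuous fun c : Ω → ℝ => weightedFreq c E := by
  classical
  refine continuous_finsetSum _ fun ω _ => ?_
  split_ifs <;> fun_prop

open Filter Topology in
/-- If `α ^ r * β` is a function of `Q`, then `Q` is constant on the curves `α ^ r * β = s`. -/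
theorem exists_eq_on_curve {r : ℕ} {Q : ℝ → ℝ → ℝ} (hcont : Continuous fun p : ℝ × ℝ => Q p.1 p.2)
    (hfun : ∀ {α β α' β' : ℝ}, (0 < α ∧ 0 < β ∧ α + β < 1) → (0 < α' ∧ 0 < β' ∧ α' + β' < 1) →
      Q α β = Q α' β' → α ^ r * β = α' ^ r * β') {s : ℝ} (hs : s ∈ Set.Ioo (0 : ℝ) ((1 / 4) ^ r / 4)) :
    ∃ q, ∀ α ∈ Set.Icc (1 / 4 : ℝ) (1 / 2), Q α (s / α ^ r) = q := by
  have hcurve : ∀ α ∈ Set.Icc (1 / 4 : ℝ) (1 / 2),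
      0 < α ∧ 0 < s / α ^ r ∧ α + s / α ^ r < 1 := by
    intro α hα
    have h0 : 0 < α := by linarith [hα.1]
    have h1 : 0 < α ^ r := by positivity
    have h2 : (1 / 4 : ℝ) ^ r ≤ α ^ r := pow_le_pow_left₀ (by norm_num) hα.1 r
    refine ⟨h0, div_pos hs.1 h1, ?_⟩
    have h3 : s / α ^ r ≤ 1 / 4 := by
      rw [div_le_iff₀ h1]
      linarith [hs.2]
    linarith [hα.2]
  have hconst : ∀ α₁ ∈ Set.Icc (1 / 4 : ℝ) (1 / 2),
      ∀ α₂ ∈ Set.Icc (1 / 4 : ℝ) (1 / 2), ¬ Q α₁ (s / α₁ ^ r) < Q α₂ (s / α₂ ^ r) := by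
    intro α₁ h₁ α₂ h₂ hlt
    have hsub : Set.uIcc α₁ α₂ ⊆ Set.Icc (1 / 4 : ℝ) (1 / 2) :=
      Set.ordConnected_Icc.uIcc_subset h₁ h₂
    have hcq : ContinuousOn (fun α => Q α (s / α ^ r)) (Set.uIcc α₁ α₂) := by
      refine hcont.comp_continuousOn (continuousOn_id.prodMk
        (continuousOn_const.div (continuousOn_id.pow r) fun α hα => ?_))
      exact pow_ne_zero r (hcurve α (hsub hα)).1.ne'
    have hivt : ∀ z ∈ Set.Ioo (Q α₁ (s / α₁ ^ r)) (Q α₂ (s / α₂ ^ r)),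
        ∃ α ∈ Set.Icc (1 / 4 : ℝ) (1 / 2), Q α (s / α ^ r) = z := by
      intro z hz
      obtain ⟨α, hα, h⟩ := intermediate_value_uIcc hcq
        (Set.Icc_subset_uIcc (Set.Ioo_subset_Icc_self hz))
      exact ⟨α, hsub hα, h⟩
    -- If `Q` varied along the curve, its values there would fill an interval. Raising `β` slightly
    -- at a point with an interior value leaves the curve but keeps `Q` in that interval, so some
    -- point of the curve shares its value.
    obtain ⟨z, hz⟩ := exists_between hlt
    obtain ⟨α₀, h₀, hα₀⟩ := hivt z hz
    obtain ⟨hp1, hp2, hp3⟩ := hcurve α₀ h₀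
    have hc0 : Continuous fun β => Q α₀ β := hcont.comp (Continuous.prodMk_right α₀)
    have e1 : ∀ᶠ β in 𝓝 (s / α₀ ^ r), Q α₀ β ∈ Set.Ioo (Q α₁ (s / α₁ ^ r)) (Q α₂ (s / α₂ ^ r)) := by
      refine hc0.continuousAt.eventually (isOpen_Ioo.mem_nhds ?_)
      change Q α₀ (s / α₀ ^ r) ∈ _
      rw [hα₀]
      exact hz
    have e2 : ∀ᶠ β in 𝓝 (s / α₀ ^ r), β < 1 - α₀ :=
      isOpen_Iio.mem_nhds (by rw [Set.mem_Iio]; linarith)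
    obtain ⟨β, ⟨hb1, hb2⟩, hb3⟩ := (((e1.and e2).filter_mono nhdsWithin_le_nhds).and
      (self_mem_nhdsWithin (s := Set.Ioi (s / α₀ ^ r)))).exists
    obtain ⟨α, hα, he⟩ := hivt _ hb1
    have hb3' : s / α₀ ^ r < β := hb3
    have := hfun (hcurve α hα) ⟨hp1, hp2.trans hb3', by linarith⟩ he
    have hne : α ^ r ≠ 0 := pow_ne_zero r (hcurve α hα).1.ne'
    have hpos : 0 < α₀ ^ r := by positivity
    rw [mul_div_cancel₀ _ hne] at this
    rw [div_lt_iff₀ hpos] at hb3'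
    linarith
  exact ⟨Q (1 / 4) (s / (1 / 4) ^ r), fun α hα =>
    le_antisymm (not_lt.1 (hconst _ (by norm_num) α hα)) (not_lt.1 (hconst α hα _ (by norm_num)))⟩

/-- The polynomial `α ^ r * β` is not a function of any frequency polynomial of degree `r`. -/
theorem exists_weightedFreq_eq_and_ne {r : ℕ} (N : Set (Fin r → Fin 3)) :
    ∃ α β α' β' : ℝ, (0 < α ∧ 0 < β ∧ α + β < 1) ∧ (0 < α' ∧ 0 < β' ∧ α' + β' < 1) ∧
      weightedFreq ![α, β, 1 - α - β] N = weightedFreq ![α', β', 1 - α' - β'] N ∧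
      α ^ r * β ≠ α' ^ r * β' := by
  by_contra! hcon
  have hcont : Continuous fun p : ℝ × ℝ => weightedFreq ![p.1, p.2, 1 - p.1 - p.2] N := by
    refine (continuous_weightedFreq N).comp (continuous_pi fun i => ?_)
    fin_cases i
    · exact continuous_fst
    · exact continuous_snd
    · exact (continuous_const.sub continuous_fst).sub continuous_snd
  obtain ⟨q, hq⟩ := weightedFreq_eq_const N (s₀ := (1 / 4) ^ r / 4) (by positivity)
    fun s hs => exists_eq_on_curve (Q := fun α β => weightedFreq ![α, β, 1 - α - β] N) hcont
      (fun h h' e => hcon _ _ _ _ h h' e) hs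
  have := hcon (1 / 2) (1 / 4) (1 / 2) (1 / 8) (by norm_num) (by norm_num)
    ((hq _ _ (by norm_num)).trans (hq _ _ (by norm_num)).symm)
  have h2 : (0 : ℝ) < (1 / 2) ^ r := by positivity
  linarith

/-! ### One hypergraph of smaller arity does not suffice -/

/-- Two distinct members differ at some vertex `v` of some link, and then the links there shatter
`{v}`. -/
theorem subsingleton_of_gVC_eq_zero {V : Type*} [Fintype V] {k : ℕ} {G : Set (KHypergraph V (k + 1))}
    (hG : gVC (k + 1) G = 0) : G.Subsingleton := by
  classical
  have hlink : ∀ h ∈ G, ∀ h' ∈ G, ∀ u : Fin k → V, h.link u ⊆ h'.link u := by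
    intro h hh h' hh' u v hv
    by_contra hv'
    have hle := vcDim_links_le_gVC G u
    rw [hG] at hle
    set 𝒜 := Finset.univ.filter fun D : Finset V => ∃ h ∈ G, h.link u = D with h𝒜
    have hmem : ∀ h ∈ G, h.link u ∈ 𝒜 := fun h hh => by
      rw [h𝒜, Finset.mem_filter]
      exact ⟨Finset.mem_univ _, h, hh, rfl⟩
    have : 𝒜.Shatters {v} := by
      intro t ht
      rcases Finset.subset_singleton_iff.1 ht with rfl | rfl
      · exact ⟨_, hmem h' hh', by simp [hv']⟩
      · exact ⟨_, hmem h hh, by simp [hv]⟩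
    have hcard := this.card_le_vcDim
    rw [Finset.card_singleton] at hcard
    have hle' : 𝒜.vcDim ≤ 0 := by convert hle
    omega
  intro h hh h' hh'
  ext v
  have hmem := fun g : KHypergraph V (k + 1) => KHypergraph.mem_link (h := g) (u := Fin.tail v)
    (v := v 0)
  simp only [Fin.cons_self_tail] at hmem
  rw [← hmem, ← hmem]
  exact ⟨fun H => hlink h hh h' hh' _ H, fun H => hlink h' hh' h hh _ H⟩

/-- The tuples with one entry `b` and all other entries `a`. -/
def singleDefectEdges {V : Type*} {k : ℕ} (a b : V) : Set (Fin k → V) :=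
  {v | ∃ i, v = Function.update (fun _ => a) i b}

theorem weightedFreq_singleDefectEdges {r : ℕ} (c : Fin 3 → ℝ) :
    weightedFreq c (singleDefectEdges (k := r + 1) 0 1) = (r + 1) * (c 0 ^ r * c 1) := by
  classical
  have hset : (Finset.univ.filter fun ω : Fin (r + 1) → Fin 3 => ω ∈ singleDefectEdges 0 1) =
      Finset.univ.image fun i => Function.update (fun _ => 0) i 1 := by
    ext ω
    rw [Finset.mem_filter, Finset.mem_image]
    exact ⟨fun ⟨_, i, hi⟩ => ⟨i, Finset.mem_univ i, hi.symm⟩,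
      fun ⟨i, _, hi⟩ => ⟨Finset.mem_univ _, i, hi.symm⟩⟩
  rw [weightedFreq, ← Finset.sum_filter, hset, Finset.sum_image]
  · have : ∀ i : Fin (r + 1), ∏ j, c ((Function.update (fun _ => 0) i 1 : Fin (r + 1) → Fin 3) j) =
        c 0 ^ r * c 1 := by
      intro i
      rw [Fin.prod_univ_succAbove _ i]
      simp [mul_comm]
    rw [Finset.sum_congr rfl fun i _ => this i]
    simp
  · intro i _ j _ hij
    by_contra hne
    have := congrFun hij i
    simp [hne] at this

/-- A hypergraph that contains, among the tuples of three vertices, those with one entry `φ 1` and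
all other entries `φ 0`, is not governed by fewer than two hypergraphs of smaller arity. -/
theorem gVC_ne_zero_and_le {V : Type*} [Fintype V] {r : ℕ} (φ : Fin 3 → V)
    (g : KHypergraph V (r + 2))
    (hg : ∀ ω : Fin (r + 2) → Fin 3, φ ∘ ω ∈ g.edges ↔ ω ∈ singleDefectEdges 0 1)
    {ε : ℝ} (hε : 0 < ε) (ℋ : Set (KHypergraph V (r + 1)))
    (H : ∀ p₁ p₂ : PMF V, ε * ipm {g} p₁ p₂ ≤ ipm ℋ p₁ p₂) :
    gVC (r + 1) ℋ ≠ 0 ∧ ε ≤ 4 := by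
  have hpmf : ∀ α β : ℝ, 0 ≤ α → 0 ≤ β → α + β ≤ 1 → ∃ P : PMF V,
      (∀ h : KHypergraph V (r + 1),
        edgeFreq P h = weightedFreq ![α, β, 1 - α - β] {ω | φ ∘ ω ∈ h.edges}) ∧
      edgeFreq P g = (r + 2) * (α ^ (r + 1) * β) := by
    intro α β hα hβ hαβ
    obtain ⟨P, -, hP⟩ := exists_pmf_edgeFreq_eq φ (c := ![α, β, 1 - α - β])
      (fun i => by fin_cases i <;> simp <;> linarith) (by simp [Fin.sum_univ_three])
    refine ⟨P, fun h => hP _ h, ?_⟩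
    have hset : {ω | φ ∘ ω ∈ g.edges} = singleDefectEdges 0 1 := Set.ext hg
    rw [hP, hset, weightedFreq_singleDefectEdges]
    push_cast
    ring
  constructor
  · intro h0
    have hsub := subsingleton_of_gVC_eq_zero h0
    obtain ⟨N, hN⟩ : ∃ N : Set (Fin (r + 1) → Fin 3), ∀ h ∈ ℋ, {ω | φ ∘ ω ∈ h.edges} = N := by
      rcases hsub.eq_empty_or_singleton with rfl | ⟨h, rfl⟩
      · exact ⟨∅, by simp⟩
      · exact ⟨{ω | φ ∘ ω ∈ h.edges}, by simp⟩
    obtain ⟨α, β, α', β', ⟨h1, h2, h3⟩, ⟨h1', h2', h3'⟩, heq, hne⟩ :=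
      exists_weightedFreq_eq_and_ne N
    obtain ⟨P, hP, hPg⟩ := hpmf α β h1.le h2.le h3.le
    obtain ⟨P', hP', hPg'⟩ := hpmf α' β' h1'.le h2'.le h3'.le
    have hle : ipm ℋ P P' ≤ 0 := ipm_le le_rfl fun h hh => by
      rw [hP, hP', hN h hh, heq]
      simp
    have := H P P'
    rw [ipm_singleton, hPg, hPg', ← mul_sub, abs_mul] at this
    have hpos : 0 < |α ^ (r + 1) * β - α' ^ (r + 1) * β'| := abs_pos.2 (sub_ne_zero.2 hne)
    have hr : 0 < |(r : ℝ) + 2| := abs_pos.2 (by positivity)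
    have : 0 < ε * (|(r : ℝ) + 2| * |α ^ (r + 1) * β - α' ^ (r + 1) * β'|) := by positivity
    linarith
  -- This `t` makes the defect likely: `(r + 2) * t = 1 / 2`, and Bernoulli's inequality keeps `(1 -
  -- t) ^ (r + 1)` above `1 / 2`. So the metric of `g` is at least `1 / 4`, against at most `1` for
  -- `ℋ`.
  · set t : ℝ := 1 / (2 * (r + 2)) with ht
    have ht0 : 0 < t := by positivity
    have htr : (r + 2) * t = 1 / 2 := by
      rw [ht]
      field_simp
    have ht1 : t ≤ 1 := by nlinarith
    obtain ⟨P, -, hPg⟩ := hpmf (1 - t) t (by linarith) ht0.le (by linarith)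
    obtain ⟨P', -, hPg'⟩ := hpmf 1 0 zero_le_one le_rfl (by norm_num)
    have hbern : 1 / 2 ≤ (1 - t) ^ (r + 1) := by
      have := one_add_mul_le_pow (a := -t) (by linarith) (r + 1)
      push_cast at this
      rw [← sub_eq_add_neg] at this
      nlinarith
    have hL : 1 / 4 ≤ (r + 2) * ((1 - t) ^ (r + 1) * t) := by nlinarith
    have := (H P P').trans (ipm_le_one ℋ P P')
    rw [ipm_singleton, hPg, hPg', mul_zero, mul_zero, sub_zero] at this
    nlinarith [le_abs_self ((r + 2) * ((1 - t) ^ (r + 1) * t) : ℝ)]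

/-! ### The hypergraph of dealings -/

theorem singleDefectEdges_comp {V : Type*} {k : ℕ} {a b : V} (π : Equiv.Perm (Fin k))
    {v : Fin k → V} (hv : v ∈ singleDefectEdges a b) : v ∘ π ∈ singleDefectEdges a b := by
  obtain ⟨i, rfl⟩ := hv
  refine ⟨π.symm i, ?_⟩
  rw [Function.update_comp_equiv]
  rfl

theorem sum_prod_le_weightedFreq {Ω ι : Type*} [Fintype Ω] [Fintype ι] {k : ℕ} {c : Ω → ℝ}
    (hc : ∀ ω, 0 ≤ c ω) {E : Set (Fin k → Ω)} (x : ι ↪ (Fin k → Ω)) (hx : ∀ i, x i ∈ E) :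
    ∑ i, ∏ l, c (x i l) ≤ weightedFreq c E := by
  classical
  calc ∑ i, ∏ l, c (x i l) = ∑ ω ∈ Finset.univ.map x, ∏ l, c (ω l) :=
        (Finset.sum_map Finset.univ x fun ω => ∏ l, c (ω l)).symm
    _ = ∑ ω ∈ Finset.univ.map x, if ω ∈ E then ∏ l, c (ω l) else 0 := by
        refine Finset.sum_congr rfl fun ω hω => ?_
        obtain ⟨i, -, rfl⟩ := Finset.mem_map.1 hω
        rw [if_pos (hx i)]
    _ ≤ weightedFreq c E := by
        refine Finset.sum_le_sum_of_subset_of_nonneg (Finset.subset_univ _) fun ω _ _ => ?_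
        split_ifs
        · exact Finset.prod_nonneg fun i _ => hc _
        · rfl

namespace ThresholdScheme

variable {V T F : Type*} [AddGroup F] {K r m : ℕ}

/-- The tuples that consist of one bit of the secret of a dealing and of `r + 1` of its shares. -/
def dealingEdges (A : ThresholdScheme T F K r) (bits : F ≃ (Fin m → Bool))
    (e : (Fin K × F) ⊕ ((Fin m × Bool) ⊕ Fin 3) ↪ V) : Set (Fin (r + 2) → V) :=
  {v | ∃ (t : T) (i₀ : Fin (r + 2)) (y : Fin m) (J : Fin (r + 2) → Fin K),
    Set.InjOn J {i | i ≠ i₀} ∧ v i₀ = e (.inr (.inl (y, bits (A.secret t) y))) ∧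
      ∀ i, i ≠ i₀ → v i = e (.inl (J i, A.share t (J i)))}

theorem dealingEdges_comp (A : ThresholdScheme T F K r) (bits : F ≃ (Fin m → Bool))
    (e : (Fin K × F) ⊕ ((Fin m × Bool) ⊕ Fin 3) ↪ V) (π : Equiv.Perm (Fin (r + 2)))
    {v : Fin (r + 2) → V} (hv : v ∈ A.dealingEdges bits e) : v ∘ π ∈ A.dealingEdges bits e := by
  obtain ⟨t, i₀, y, J, hJ, h0, h1⟩ := hv
  have hne : ∀ i, i ≠ π.symm i₀ → π i ≠ i₀ := fun i hi h => hi (by rw [← h, π.symm_apply_apply])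
  refine ⟨t, π.symm i₀, y, J ∘ π, ?_, by simpa using h0, fun i hi => h1 _ (hne i hi)⟩
  intro i hi i' hi' h
  exact π.injective (hJ (hne i hi) (hne i' hi') h)

/-- The hypergraph of the dealings of a threshold scheme, with the tuples of one of two further
vertices that have one entry equal to the other. -/
def hypergraph (A : ThresholdScheme T F K r) (bits : F ≃ (Fin m → Bool))
    (e : (Fin K × F) ⊕ ((Fin m × Bool) ⊕ Fin 3) ↪ V) : KHypergraph V (r + 2) where
  edges := A.dealingEdges bits e ∪ singleDefectEdges (e (.inr (.inr 0))) (e (.inr (.inr 1)))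
  undirected π _ hv := hv.imp (A.dealingEdges_comp bits e π) (singleDefectEdges_comp π)

theorem comp_mem_hypergraph_iff (A : ThresholdScheme T F K r) (bits : F ≃ (Fin m → Bool))
    (e : (Fin K × F) ⊕ ((Fin m × Bool) ⊕ Fin 3) ↪ V) (ω : Fin (r + 2) → Fin 3) :
    (fun i => e (.inr (.inr i))) ∘ ω ∈ (A.hypergraph bits e).edges ↔
      ω ∈ singleDefectEdges 0 1 := by
  have hinj : Function.Injective fun i : Fin 3 => e (.inr (.inr i)) := fun i j h => by
    simpa using h
  have hupd : ∀ i : Fin (r + 2),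
      (fun i => e (.inr (.inr i))) ∘ Function.update (fun _ => (0 : Fin 3)) i 1 =
        Function.update (fun _ => e (.inr (.inr 0))) i (e (.inr (.inr 1))) := fun i => by
    rw [Function.comp_update]
    rfl
  constructor
  · rintro (⟨t, i₀, y, J, -, h0, -⟩ | ⟨i, hi⟩)
    · simp at h0
    · exact ⟨i, hinj.comp_left (hi.trans (hupd i).symm)⟩
  · rintro ⟨i, rfl⟩
    exact Or.inr ⟨i, hupd i⟩

/-- The vertices of the distribution that mixes the shares of `t` with the bits `τ`. -/
def mixPoint (A : ThresholdScheme T F K r) (e : (Fin K × F) ⊕ ((Fin m × Bool) ⊕ Fin 3) ↪ V) (t : T)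
    (τ : Fin m → Bool) : Fin m ⊕ Fin K → V :=
  Sum.elim (fun y => e (.inr (.inl (y, τ y)))) fun j => e (.inl (j, A.share t j))

/-- The weights of the distribution that draws a bit with probability `p` and else a share. -/
noncomputable def mixWeight (K m : ℕ) (p : ℝ) : Fin m ⊕ Fin K → ℝ :=
  Sum.elim (fun _ => p / m) fun _ => (1 - p) / K

theorem mixWeight_nonneg {p : ℝ} (h0 : 0 ≤ p) (h1 : p ≤ 1) (ω : Fin m ⊕ Fin K) :
    0 ≤ mixWeight K m p ω := by
  have : 0 ≤ 1 - p := by linarith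
  rcases ω with y | j <;> simp only [mixWeight, Sum.elim_inl, Sum.elim_inr] <;> positivity

theorem sum_mixWeight (hK : 0 < K) (hm : 0 < m) (p : ℝ) : ∑ ω, mixWeight K m p ω = 1 := by
  have hK' : (K : ℝ) ≠ 0 := by positivity
  have hm' : (m : ℝ) ≠ 0 := by positivity
  simp only [mixWeight, Fintype.sum_sum_type, Sum.elim_inl, Sum.elim_inr, Finset.sum_const,
    Finset.card_univ, Fintype.card_fin, nsmul_eq_mul]
  field_simp
  ring

/-- Birthday bound: `r + 1` draws among `K` positions are distinct with probability at least `1 /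
2`. -/
theorem half_le_descFactorial_div (hK : 2 * (r + 2) ^ 2 ≤ K) :
    (K : ℝ) ^ (r + 1) / 2 ≤ K.descFactorial (r + 1) := by
  have hK0 : (0 : ℝ) < K := by
    have : 0 < K := lt_of_lt_of_le (by positivity) hK
    exact_mod_cast this
  have hKr : r ≤ K := by nlinarith
  have h1 : (((K - r) ^ (r + 1) : ℕ) : ℝ) ≤ K.descFactorial (r + 1) := by
    have := Nat.pow_sub_le_descFactorial K (r + 1)
    rw [Nat.add_sub_add_right] at this
    exact_mod_cast this
  rw [Nat.cast_pow, Nat.cast_sub hKr] at h1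
  have hK2 : 2 * ((r : ℝ) + 2) ^ 2 ≤ K := by exact_mod_cast hK
  have hr : (r : ℝ) * (r + 1) / K ≤ 1 / 2 := by
    rw [div_le_iff₀ hK0]
    nlinarith [(Nat.cast_nonneg r : (0 : ℝ) ≤ r)]
  have hr1 : (r : ℝ) / K ≤ 1 := (div_le_one hK0).2 (by exact_mod_cast hKr)
  have hb := one_add_mul_le_pow (a := -((r : ℝ) / K)) (by linarith) (r + 1)
  have h2 : (1 : ℝ) / 2 ≤ (1 + -((r : ℝ) / K)) ^ (r + 1) := by
    refine le_trans ?_ hb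
    push_cast
    have : ((r : ℝ) + 1) * -(r / K) = -(r * (r + 1) / K) := by ring
    linarith
  have h3 : ((K : ℝ) - r) ^ (r + 1) = K ^ (r + 1) * (1 + -((r : ℝ) / K)) ^ (r + 1) := by
    rw [← mul_pow]
    congr 1
    field_simp
    ring
  rw [h3] at h1
  refine le_trans ?_ h1
  have : (0 : ℝ) < K ^ (r + 1) := by positivity
  nlinarith

/-- The correct bits of the secret produce edges with constant probability. -/
theorem eighth_le_weightedFreq (A : ThresholdScheme T F K r) (bits : F ≃ (Fin m → Bool))
    (e : (Fin K × F) ⊕ ((Fin m × Bool) ⊕ Fin 3) ↪ V) (t : T) (hm : 0 < m)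
    (hK : 2 * (r + 2) ^ 2 ≤ K) :
    1 / 8 ≤ weightedFreq (mixWeight K m (1 / (2 * (r + 2))))
      {ω | A.mixPoint e t (bits (A.secret t)) ∘ ω ∈ (A.hypergraph bits e).edges} := by
  set p : ℝ := 1 / (2 * (r + 2)) with hp
  have hp0 : 0 < p := by positivity
  have hpr : (r + 2) * p = 1 / 2 := by
    rw [hp]
    field_simp
  have hp1 : p ≤ 1 := by nlinarith
  -- These tuples have one bit, at the chosen coordinate, and distinct share positions elsewhere.
  let x : Fin (r + 2) × Fin m × (Fin (r + 1) ↪ Fin K) → (Fin (r + 2) → Fin m ⊕ Fin K) := fun a =>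
    a.1.insertNth (.inl a.2.1) fun l => .inr (a.2.2 l)
  have hxinj : Function.Injective x := by
    rintro ⟨i, y, j⟩ ⟨i', y', j'⟩ h
    have hii : i = i' := by
      by_contra hne
      obtain ⟨l, rfl⟩ := Fin.exists_succAbove_eq hne
      have := congrFun h (i'.succAbove l)
      simp [x] at this
    subst hii
    have hy := congrFun h i
    simp only [x, Fin.insertNth_apply_same, Sum.inl.injEq] at hy
    subst hy
    have hj : j = j' := by
      ext l
      have := congrFun h (i.succAbove l)
      simp only [x, Fin.insertNth_apply_succAbove, Sum.inr.injEq] at this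
      rw [this]
    rw [hj]
  have hxmem : ∀ a, x a ∈ {ω | A.mixPoint e t (bits (A.secret t)) ∘ ω ∈
      (A.hypergraph bits e).edges} := by
    rintro ⟨i, y, j⟩
    have hl : ∀ a, a ≠ i → ∃ l, i.succAbove l = a := fun a ha => Fin.exists_succAbove_eq ha
    refine Or.inl ⟨t, i, y, i.insertNth (j 0) j, ?_, ?_, ?_⟩
    · intro a ha b hb hab
      obtain ⟨l, rfl⟩ := hl a ha
      obtain ⟨l', rfl⟩ := hl b hb
      simp only [Fin.insertNth_apply_succAbove] at hab
      rw [j.injective hab]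
    · simp [x, mixPoint]
    · intro a ha
      obtain ⟨l, rfl⟩ := hl a ha
      simp [x, mixPoint]
  refine le_trans ?_ (sum_prod_le_weightedFreq (mixWeight_nonneg hp0.le hp1) ⟨x, hxinj⟩ hxmem)
  have hterm : ∀ a, ∏ l, mixWeight K m p (x a l) = p / m * ((1 - p) / K) ^ (r + 1) := by
    rintro ⟨i, y, j⟩
    rw [Fin.prod_univ_succAbove _ i]
    simp [x, mixWeight, div_pow]
  have hK0 : (0 : ℝ) < K := by
    have : 0 < K := lt_of_lt_of_le (by positivity) hK
    exact_mod_cast this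
  have hm0 : (0 : ℝ) < m := by exact_mod_cast hm
  have hbern : 1 / 2 ≤ (1 - p) ^ (r + 1) := by
    have := one_add_mul_le_pow (a := -p) (by linarith) (r + 1)
    push_cast at this
    rw [← sub_eq_add_neg] at this
    nlinarith
  -- The three factors, for the place of the bit, the other draws being shares, and the distinctness
  -- of their positions, are each at least `1 / 2`.
  have hcard : ∑ a, ∏ l, mixWeight K m p (x a l) =
      (r + 2) * p * ((1 - p) ^ (r + 1) * (K.descFactorial (r + 1) / K ^ (r + 1))) := by
    simp only [hterm, Finset.sum_const, Finset.card_univ, Fintype.card_prod, Fintype.card_fin,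
      Fintype.card_embedding_eq, nsmul_eq_mul]
    push_cast
    rw [div_pow]
    field_simp
  have hdesc : (1 : ℝ) / 2 ≤ K.descFactorial (r + 1) / K ^ (r + 1) := by
    rw [le_div_iff₀ (by positivity)]
    linarith [half_le_descFactorial_div hK]
  change 1 / 8 ≤ ∑ a, ∏ l, mixWeight K m p (x a l)
  rw [hcard, hpr]
  nlinarith

/-- The wrong bits of the secret produce no edges. -/
theorem weightedFreq_not_eq_zero (A : ThresholdScheme T F K r) (bits : F ≃ (Fin m → Bool))
    (e : (Fin K × F) ⊕ ((Fin m × Bool) ⊕ Fin 3) ↪ V) (t : T) (c : Fin m ⊕ Fin K → ℝ) :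
    weightedFreq c {ω | A.mixPoint e t (fun y => !bits (A.secret t) y) ∘ ω ∈
      (A.hypergraph bits e).edges} = 0 := by
  classical
  refine Finset.sum_eq_zero fun ω _ => if_neg ?_
  rintro (⟨t', i₀, y, J, hJ, h0, h1⟩ | ⟨i, hi⟩)
  -- An edge may belong to another dealing `t'`, but its `r + 1` shares agree with those of `t`,
  -- which forces equal secrets and contradicts the flipped bit.
  · have hshare : ∀ i, i ≠ i₀ → A.share t (J i) = A.share t' (J i) := by
      intro i hi
      have := h1 i hi
      rcases hω : ω i with y' | j
      · simp [mixPoint, hω] at this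
      · simp only [mixPoint, Function.comp_apply, hω, Sum.elim_inr, EmbeddingLike.apply_eq_iff_eq,
          Sum.inl.injEq, Prod.mk.injEq] at this
        rw [← this.1, this.2, this.1]
    have hsecret : A.secret t = A.secret t' := by
      refine A.secret_eq t t' ((Finset.univ.erase i₀).image J) ?_ ?_
      · rw [Finset.card_image_of_injOn fun i hi j hj h =>
          hJ (by simpa using hi) (by simpa using hj) h]
        simp
      · intro j hj
        obtain ⟨i, hi, rfl⟩ := Finset.mem_image.1 hj
        exact hshare i (Finset.ne_of_mem_erase hi)
    rcases hω : ω i₀ with y' | j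
    · simp only [mixPoint, Function.comp_apply, hω, Sum.elim_inl, EmbeddingLike.apply_eq_iff_eq,
        Sum.inr.injEq, Sum.inl.injEq, Prod.mk.injEq] at h0
      obtain ⟨rfl, h⟩ := h0
      rw [hsecret] at h
      simp at h
    · simp [mixPoint, hω] at h0
  · have := congrFun hi i
    rcases hω : ω i with y' | j <;> simp [mixPoint, hω] at this

/-- The vertices that a list of positions denotes for the dealing `t`. -/
def position (A : ThresholdScheme T F K r) (e : (Fin K × F) ⊕ ((Fin m × Bool) ⊕ Fin 3) ↪ V) (t : T) :
    Fin K ⊕ (Fin m × Bool) → V :=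
  Sum.elim (fun j => e (.inl (j, A.share t j))) fun y => e (.inr (.inl y))

-- Both mixtures give the shares the same weight, so only the bits contribute.
open Classical in
theorem sum_pushWeight_sub (A : ThresholdScheme T F K r) [Fintype V]
    (e : (Fin K × F) ⊕ ((Fin m × Bool) ⊕ Fin 3) ↪ V) (t : T) (τ : Fin m → Bool) (p : ℝ)
    (D : Finset V) :
    ∑ v ∈ D, (pushWeight (A.mixPoint e t τ) (mixWeight K m p) v -
        pushWeight (A.mixPoint e t fun y => !τ y) (mixWeight K m p) v) =
      p / m * ∑ y, boolSign (τ y) * ((if e (.inr (.inl (y, true))) ∈ D then 1 else 0) -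
        (if e (.inr (.inl (y, false))) ∈ D then 1 else 0)) := by
  have key : ∀ φ : Fin m ⊕ Fin K → V, ∑ v ∈ D, pushWeight φ (mixWeight K m p) v =
      ∑ ω, mixWeight K m p ω * (if φ ω ∈ D then 1 else 0) := by
    intro φ
    rw [← sum_pushWeight_mul φ _ fun v => if v ∈ D then 1 else 0]
    simp
  rw [Finset.sum_sub_distrib, key, key]
  have hshare : ∀ τ' : Fin m → Bool, (∑ j : Fin K, mixWeight K m p (.inr j) *
      (if A.mixPoint e t τ' (.inr j) ∈ D then 1 else 0)) = ∑ j : Fin K, mixWeight K m p (.inr j) *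
      (if e (.inl (j, A.share t j)) ∈ D then 1 else 0) := fun _ => rfl
  rw [Fintype.sum_sum_type, Fintype.sum_sum_type, hshare, hshare, add_sub_add_right_eq_sub,
    ← Finset.sum_sub_distrib, Finset.mul_sum]
  refine Finset.sum_congr rfl fun y _ => ?_
  change p / m * (if e (.inr (.inl (y, τ y))) ∈ D then 1 else 0) -
    p / m * (if e (.inr (.inl (y, !τ y))) ∈ D then 1 else 0) = _
  rw [← mul_sub]
  cases τ y <;> simp only [boolSign, Bool.not_true, Bool.not_false, if_true, Bool.false_eq_true,
    if_false] <;> ring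

/-- If the union bound were below `1`, some dealing would have an uncorrelated secret; its correct
and flipped mixtures are then separated by the hypergraph but nearly indistinguishable for `ℋ`. -/
theorem one_le_of_ipm_le [Fintype V] [Fintype T] [Nonempty T] (A : ThresholdScheme T F K r)
    (bits : F ≃ (Fin m → Bool)) (e : (Fin K × F) ⊕ ((Fin m × Bool) ⊕ Fin 3) ↪ V) (hm : 0 < m)
    (hK : 2 * (r + 2) ^ 2 ≤ K) {ε : ℝ} (hε : 0 < ε) (ℋ : Set (KHypergraph V (r + 1)))
    (H : ∀ p₁ p₂ : PMF V, ε * ipm {A.hypergraph bits e} p₁ p₂ ≤ ipm ℋ p₁ p₂) :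
    1 ≤ (K + 2 * m : ℝ) ^ r * ((2 * m + 1) ^ gVC (r + 1) ℋ *
      (2 * Real.exp (-((ε / 8) ^ 2 * m / 2)))) := by
  classical
  by_contra! hsmall
  let ψ : Fin m × Bool ↪ V := (Function.Embedding.inl.trans Function.Embedding.inr).trans e
  let 𝒜 : (Fin r → Fin K ⊕ (Fin m × Bool)) → T → Finset (Finset V) := fun i t =>
    Finset.univ.filter fun D => ∃ h ∈ ℋ, h.link (A.position e t ∘ i) = D
  let 𝒟 : (Fin r → Fin K ⊕ (Fin m × Bool)) → T → Finset (Finset (Fin m × Bool)) := fun i t =>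
    (𝒜 i t).image fun D => Finset.univ.filter fun y => ψ y ∈ D
  let J : (Fin r → Fin K ⊕ (Fin m × Bool)) → Finset (Fin K) := fun i =>
    Finset.univ.filter fun j => ∃ l, i l = .inl j
  have hJ : ∀ i, (J i).card ≤ r := fun i => by
    have hsub : (J i).map Function.Embedding.inl ⊆ Finset.univ.image i := by
      intro a ha
      obtain ⟨j, hj, rfl⟩ := Finset.mem_map.1 ha
      obtain ⟨l, hl⟩ := (Finset.mem_filter.1 hj).2
      exact Finset.mem_image.2 ⟨l, Finset.mem_univ l, hl⟩
    rw [← Finset.card_map (Function.Embedding.inl (β := Fin m × Bool))]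
    refine (Finset.card_le_card hsub).trans (Finset.card_image_le.trans ?_)
    simp
  have hM : ∀ i t, ((𝒟 i t).card : ℝ) ≤ (2 * m + 1) ^ gVC (r + 1) ℋ := fun i t => by
    have h1 : (𝒟 i t).card ≤ (Fintype.card (Fin m × Bool) + 1) ^ (𝒜 i t).vcDim := by
      convert card_traces_le (𝒜 i t) ψ
    have h2 : (𝒜 i t).vcDim ≤ gVC (r + 1) ℋ := by
      convert vcDim_links_le_gVC ℋ (A.position e t ∘ i)
    have h3 : (𝒟 i t).card ≤ (2 * m + 1) ^ gVC (r + 1) ℋ := by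
      refine h1.trans ((Nat.pow_le_pow_right (Nat.succ_pos _) h2).trans ?_)
      simp [mul_comm m 2]
    exact_mod_cast h3
  have h𝒟 : ∀ i t t', (∀ j ∈ J i, A.share t j = A.share t' j) → 𝒟 i t = 𝒟 i t' := fun i t t' hJ => by
    have : A.position e t ∘ i = A.position e t' ∘ i := by
      funext l
      rcases hl : i l with j | y
      · have := hJ j (Finset.mem_filter.2 ⟨Finset.mem_univ j, l, hl⟩)
        simp [position, hl, this]
      · simp [position, hl]
    simp only [𝒟, 𝒜, this]
  obtain ⟨t, ht⟩ := A.exists_uncorrelated bits J hJ 𝒟 _ hM h𝒟 (η := ε / 8) (by positivity)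
    (by simpa [mul_comm (m : ℝ) 2] using hsmall)
  set p : ℝ := 1 / (2 * (r + 2)) with hp
  have hp0 : 0 < p := by positivity
  have hpr : (r + 2) * p = 1 / 2 := by
    rw [hp]
    field_simp
  have hp1 : p ≤ 1 := by nlinarith
  have hK0 : 0 < K := lt_of_lt_of_le (by positivity) hK
  have hm0 : (0 : ℝ) < m := by exact_mod_cast hm
  set σ := bits (A.secret t) with hσ
  have hsum := sum_mixWeight hK0 hm p
  have hnonneg := mixWeight_nonneg (K := K) (m := m) hp0.le hp1
  obtain ⟨P₁, hP₁, hg₁⟩ := exists_pmf_edgeFreq_eq (A.mixPoint e t σ) hnonneg hsum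
  obtain ⟨P₂, hP₂, hg₂⟩ := exists_pmf_edgeFreq_eq (A.mixPoint e t fun y => !σ y) hnonneg hsum
  have hg : 1 / 8 ≤ ipm {A.hypergraph bits e} P₁ P₂ := by
    rw [ipm_singleton, hg₁, hg₂, A.weightedFreq_not_eq_zero, sub_zero]
    exact (A.eighth_le_weightedFreq bits e t hm hK).trans (le_abs_self _)
  -- Only vertices of positive weight matter in the hybrid bound. They are named by positions, so
  -- the union runs over `(K + 2m) ^ r` lists that do not depend on the dealing.
  have hcode : ∀ v, (P₁ v).toReal ≠ 0 ∨ (P₂ v).toReal ≠ 0 → ∃ a, A.position e t a = v := by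
    intro v hv
    rw [hP₁, hP₂] at hv
    rcases hv with hv | hv <;> obtain ⟨ω, rfl⟩ := exists_of_pushWeight_ne_zero hv <;>
      rcases ω with y | j
    · exact ⟨.inr (y, σ y), rfl⟩
    · exact ⟨.inl j, rfl⟩
    · exact ⟨.inr (y, !σ y), rfl⟩
    · exact ⟨.inl j, rfl⟩
  -- Since `(r + 1) * p < 1 / 2`, this is less than `ε / 16`, while the hypothesis demands at least
  -- `ε / 8`.
  have hℋ : ipm ℋ P₁ P₂ ≤ (r + 1) * (p * (ε / 8)) := by
    refine ipm_le (by positivity) fun h hh => ?_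
    refine abs_weightedFreq_sub_le (fun _ => ENNReal.toReal_nonneg)
      (fun _ => ENNReal.toReal_nonneg) P₁.sum_toReal_eq_one P₂.sum_toReal_eq_one h fun u hu => ?_
    choose i hi using fun l => hcode (u l) (hu l)
    obtain rfl : A.position e t ∘ i = u := funext hi
    simp only [hP₁, hP₂]
    rw [A.sum_pushWeight_sub, abs_mul, abs_of_pos (by positivity)]
    have hD : (Finset.univ.filter fun y => ψ y ∈ h.link (A.position e t ∘ i)) ∈ 𝒟 i t :=
      Finset.mem_image_of_mem _ (Finset.mem_filter.2 ⟨Finset.mem_univ _, h, hh, rfl⟩)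
    have := ht i _ hD
    simp only [Finset.mem_filter, Finset.mem_univ, true_and] at this
    refine (mul_le_mul_of_nonneg_left this (by positivity)).trans (le_of_eq ?_)
    field_simp
  have := H P₁ P₂
  nlinarith

end ThresholdScheme

/-! ### Choice of parameters and conclusion -/

/-- The hypergraph of the tuples with one entry `b` and all other entries `a`. -/
def singleDefectHypergraph {V : Type*} (k : ℕ) (a b : V) : KHypergraph V k where
  edges := singleDefectEdges a b
  undirected π _ hv := singleDefectEdges_comp π hv

theorem comp_mem_singleDefectHypergraph_iff {V : Type*} {k : ℕ} (φ : Fin 3 ↪ V)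
    (ω : Fin k → Fin 3) :
    φ ∘ ω ∈ (singleDefectHypergraph k (φ 0) (φ 1)).edges ↔ ω ∈ singleDefectEdges 0 1 := by
  have hupd : ∀ i : Fin k, φ ∘ Function.update (fun _ => (0 : Fin 3)) i 1 =
      Function.update (fun _ => φ 0) i (φ 1) := fun i => by
    rw [Function.comp_update]
    rfl
  constructor
  · rintro ⟨i, hi⟩
    exact ⟨i, φ.injective.comp_left (hi.trans (hupd i).symm)⟩
  · rintro ⟨i, rfl⟩
    exact ⟨i, hupd i⟩

theorem sauer_mul_hoeffding_lt_one {r m d : ℕ} {L ε : ℝ} (hd : 1 ≤ d) (hε : 0 < ε)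
    (hL : 4096 * ((r : ℝ) + 2) ^ 4 ≤ L) (hm : L / 2 < m + 1)
    (hlt : (d : ℝ) < 1 / 4096 * (ε ^ 2 / ((r : ℝ) + 2) ^ 2 * Real.sqrt L)) :
    (2 * ((r : ℝ) + 2) ^ 2 + 2 * m) ^ r * ((2 * m + 1) ^ d *
      (2 * Real.exp (-((ε / 8) ^ 2 * m / 2)))) < 1 := by
  have hr : (0 : ℝ) ≤ r := Nat.cast_nonneg r
  have hd' : (1 : ℝ) ≤ d := by exact_mod_cast hd
  set κ : ℝ := ((r : ℝ) + 2) ^ 2 with hκ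
  have hκ4 : ((r : ℝ) + 2) ^ 4 = κ ^ 2 := by rw [hκ]; ring
  have hκr : (r : ℝ) + 2 ≤ κ := by nlinarith
  have hκ0 : 4 ≤ κ := by nlinarith
  rw [hκ4] at hL
  have hκL : 16384 * κ ≤ L := by nlinarith
  have hm0 : (0 : ℝ) < m := by linarith
  set s := Real.sqrt L with hs
  have hs0 : 0 ≤ s := Real.sqrt_nonneg L
  set x := Real.sqrt m with hx
  have hx0 : 0 < x := Real.sqrt_pos.2 hm0
  have hxx : x ^ 2 = m := Real.sq_sqrt hm0.le
  have hsx : s ≤ 2 * x := by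
    rw [hs]
    refine Real.sqrt_le_iff.2 ⟨by positivity, ?_⟩
    rw [mul_pow, hxx]
    linarith
  -- This crude estimate of the logarithm by a square root produces the `√(log n)` of the final
  -- bound.
  have hlog : Real.log (4 * m) ≤ 4 * x := by
    have h1 : (4 * m : ℝ) = (2 * x) ^ 2 := by rw [mul_pow, hxx]; norm_num
    rw [h1, Real.log_pow]
    have := Real.log_le_sub_one_of_pos (by positivity : (0 : ℝ) < 2 * x)
    push_cast
    linarith
  have hlog0 : 0 ≤ Real.log (4 * m) := Real.log_nonneg (by linarith)
  have hdk : (d : ℝ) * κ < ε ^ 2 * s / 4096 := by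
    have : 1 / 4096 * (ε ^ 2 / κ * s) = ε ^ 2 * s / 4096 / κ := by ring
    rwa [this, lt_div_iff₀ (by linarith)] at hlt
  -- Here `1 ≤ d` absorbs the union over lists: `r + d + 1 ≤ 2 * d * κ`.
  have hexp : (r : ℝ) + d + 1 ≤ ε ^ 2 * s / 2048 := by nlinarith
  have hprod : ((r : ℝ) + d + 1) * Real.log (4 * m) < ε ^ 2 * m / 128 := by
    have hεm : 0 < ε ^ 2 * m := by positivity
    calc ((r : ℝ) + d + 1) * Real.log (4 * m) ≤ ε ^ 2 * s / 2048 * (4 * x) :=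
          mul_le_mul hexp hlog hlog0 (by positivity)
      _ ≤ ε ^ 2 * (2 * x) / 2048 * (4 * x) := by gcongr
      _ = ε ^ 2 * m / 256 := by rw [← hxx]; ring
      _ < ε ^ 2 * m / 128 := by linarith
  calc (2 * κ + 2 * m : ℝ) ^ r * ((2 * m + 1) ^ d * (2 * Real.exp (-((ε / 8) ^ 2 * m / 2))))
      ≤ (4 * m : ℝ) ^ r * ((4 * m) ^ d * (4 * m * Real.exp (-((ε / 8) ^ 2 * m / 2)))) := by
        gcongr <;> linarith
    _ = Real.exp (((r : ℝ) + d + 1) * Real.log (4 * m) - ε ^ 2 * m / 128) := by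
        have h1 : (4 * m : ℝ) ^ r * ((4 * m) ^ d * (4 * m * Real.exp (-((ε / 8) ^ 2 * m / 2)))) =
            (4 * m : ℝ) ^ (r + d + 1) * Real.exp (-((ε / 8) ^ 2 * m / 2)) := by ring
        have h2 : ((r : ℝ) + d + 1) = ((r + d + 1 : ℕ) : ℝ) := by push_cast; ring
        rw [h1, sub_eq_add_neg, Real.exp_add, h2, Real.exp_nat_mul, Real.exp_log (by linarith)]
        congr 2
        ring
    _ < 1 := Real.exp_lt_one_iff.2 (by linarith)

/-- With `m` at most half of `log n`, the field has at most `√n` elements, which leaves room in `V`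
for a factor `K` and the bit vertices; it still has more than `K` elements, as Shamir's scheme
needs. -/
theorem scheme_size_le {r n m : ℕ} (hn : 0 < n) (hL : 4096 * ((r : ℝ) + 2) ^ 4 ≤ Real.log n)
    (hm : m ≤ Real.log n / 2) (hm' : Real.log n / 2 < m + 1) :
    2 * (r + 2) ^ 2 < 2 ^ m ∧ 2 * (r + 2) ^ 2 * 2 ^ m + (m * 2 + 3) ≤ n := by
  have hr : (0 : ℝ) ≤ r := Nat.cast_nonneg r
  set L := Real.log n
  set κ : ℝ := ((r : ℝ) + 2) ^ 2 with hκ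
  have hκ4 : ((r : ℝ) + 2) ^ 4 = κ ^ 2 := by rw [hκ]; ring
  have hκ0 : 4 ≤ κ := by nlinarith
  rw [hκ4] at hL
  have hκL : 16384 * κ ≤ L := by nlinarith
  have h2m : (m : ℝ) + 1 ≤ 2 ^ m := by exact_mod_cast Nat.succ_le_of_lt (Nat.lt_two_pow_self)
  constructor
  · have : (2 * κ : ℝ) < 2 ^ m := by linarith
    rw [hκ] at this
    exact_mod_cast this
  · set E := Real.exp (L / 2) with hE
    have hEE : E * E = n := by
      rw [hE, ← Real.exp_add, add_halves, Real.exp_log (by exact_mod_cast hn)]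
    have hE1 : L / 2 + 1 ≤ E := Real.add_one_le_exp _
    have h2E : (2 : ℝ) ^ m ≤ E := by
      calc (2 : ℝ) ^ m ≤ Real.exp 1 ^ m :=
            pow_le_pow_left₀ (by norm_num) (by linarith [Real.add_one_le_exp (1 : ℝ)]) m
        _ = Real.exp m := by rw [← Real.exp_nat_mul, mul_one]
        _ ≤ E := Real.exp_le_exp.2 hm
    have : (2 * κ * 2 ^ m + (m * 2 + 3) : ℝ) ≤ n := by
      rw [← hEE]
      have h3 : 2 * κ * 2 ^ m ≤ 2 * κ * E := by gcongr
      nlinarith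
    rw [hκ] at this
    exact_mod_cast this

theorem exists_hypergraph_gVC_ge {V : Type*} [Fintype V] (r : ℕ) (hV : 3 ≤ Fintype.card V) :
    ∃ g : KHypergraph V (r + 2), ∀ ε : ℝ, 0 < ε → ∀ ℋ : Set (KHypergraph V (r + 1)),
      (∀ p₁ p₂ : PMF V, ε * ipm {g} p₁ p₂ ≤ ipm ℋ p₁ p₂) →
        1 / 4096 * (ε ^ 2 / ((r : ℝ) + 2) ^ 2 * Real.sqrt (Real.log (Fintype.card V))) ≤
          gVC (r + 1) ℋ := by
  set L := Real.log (Fintype.card V)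
  -- Above the threshold the scheme fits into `V`. Below it, `√L ≤ 64 * (r + 2) ^ 2` and `ε ≤ 4`
  -- make the claimed bound at most `1`, so a nonzero dimension suffices.
  rcases le_or_gt (4096 * ((r : ℝ) + 2) ^ 4) L with hL | hL
  · have hr : (0 : ℝ) ≤ r := Nat.cast_nonneg r
    have hr4 : 16 ≤ ((r : ℝ) + 2) ^ 4 := by
      have : (2 : ℝ) ^ 4 ≤ ((r : ℝ) + 2) ^ 4 := pow_le_pow_left₀ (by norm_num) (by linarith) 4
      linarith
    obtain ⟨m, hm, hm'⟩ : ∃ m : ℕ, (m : ℝ) ≤ L / 2 ∧ L / 2 < m + 1 :=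
      ⟨⌊L / 2⌋₊, Nat.floor_le (by linarith), Nat.lt_floor_add_one _⟩
    have hm0 : 0 < m := by
      have : (0 : ℝ) < m := by linarith
      exact_mod_cast this
    obtain ⟨hK, hn⟩ := scheme_size_le (by omega) hL hm hm'
    have : Fact (Nat.Prime 2) := ⟨Nat.prime_two⟩
    let F := GaloisField 2 m
    let : Fintype F := Fintype.ofFinite F
    have hF : Fintype.card F = 2 ^ m := by
      rw [← Nat.card_eq_fintype_card, GaloisField.card 2 m hm0.ne']
    obtain ⟨T, _, _, ⟨A⟩⟩ := exists_thresholdScheme F (K := 2 * (r + 2) ^ 2) (r := r)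
      (by rw [hF]; exact hK)
    have bits : F ≃ (Fin m → Bool) := Fintype.equivOfCardEq (by simp [hF])
    obtain ⟨e⟩ : Nonempty ((Fin (2 * (r + 2) ^ 2) × F) ⊕ ((Fin m × Bool) ⊕ Fin 3) ↪ V) := by
      refine Function.Embedding.nonempty_of_card_le ?_
      simpa [hF] using hn
    refine ⟨A.hypergraph bits e, fun ε hε ℋ H => ?_⟩
    have hd := (gVC_ne_zero_and_le _ _ (A.comp_mem_hypergraph_iff bits e) hε ℋ H).1
    by_contra! hlt
    have h1 := A.one_le_of_ipm_le bits e hm0 le_rfl hε ℋ H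
    push_cast at h1
    exact absurd h1
      (not_le.2 (sauer_mul_hoeffding_lt_one (Nat.one_le_iff_ne_zero.2 hd) hε hL hm' hlt))
  · obtain ⟨φ⟩ : Nonempty (Fin 3 ↪ V) := Function.Embedding.nonempty_of_card_le (by simpa using hV)
    refine ⟨singleDefectHypergraph (r + 2) (φ 0) (φ 1), fun ε hε ℋ H => ?_⟩
    obtain ⟨hd, hε4⟩ := gVC_ne_zero_and_le φ _ (comp_mem_singleDefectHypergraph_iff φ) hε ℋ H
    have hd' : (1 : ℝ) ≤ gVC (r + 1) ℋ := by exact_mod_cast Nat.one_le_iff_ne_zero.2 hd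
    refine le_trans ?_ hd'
    have hs : Real.sqrt L ≤ 64 * ((r : ℝ) + 2) ^ 2 := by
      refine Real.sqrt_le_iff.2 ⟨by positivity, ?_⟩
      nlinarith
    have hk : (0 : ℝ) < ((r : ℝ) + 2) ^ 2 := by positivity
    calc 1 / 4096 * (ε ^ 2 / ((r : ℝ) + 2) ^ 2 * Real.sqrt L)
        ≤ 1 / 4096 * (4 ^ 2 / ((r : ℝ) + 2) ^ 2 * (64 * ((r : ℝ) + 2) ^ 2)) := by gcongr
      _ ≤ 1 := by
        field_simp
        norm_num

theorem mainTheorem7 :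
    ∃ C : ℝ, 0 < C ∧ ∃ c : ℝ, 0 < c ∧
      ∀ (k : ℕ), 2 ≤ k → ∀ (V : Type*) [Fintype V], 3 ≤ Fintype.card V →
        ∃ 𝒢 : Set (KHypergraph V k),
          𝒢.ncard = 1 ∧
          (∃ m : ℝ → ℝ → ℕ, HasSampleComplexity 𝒢 m ∧
            ∀ ε δ : ℝ, 0 < ε → ε < 1 → 0 < δ → δ < 1 →
              (m ε δ : ℝ) ≤ C * (((k : ℝ) ^ 2 + Real.log (1 / δ)) / ε ^ 2)) ∧
          ∀ (ε : ℝ), 0 < ε → ∀ ℋ : Set (KHypergraph V (k - 1)),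
            (∀ p₁ p₂ : PMF V, ε * ipm 𝒢 p₁ p₂ ≤ ipm ℋ p₁ p₂) →
              c * (ε ^ 2 / (k : ℝ) ^ 2 * Real.sqrt (Real.log (Fintype.card V))) ≤
                (gVC (k - 1) ℋ : ℝ) := by
  refine ⟨1, one_pos, 1 / 4096, by norm_num, fun k hk V _ hV => ?_⟩
  obtain ⟨r, rfl⟩ := Nat.exists_eq_add_of_le' hk
  obtain ⟨g, hg⟩ := exists_hypergraph_gVC_ge r hV
  refine ⟨{g}, Set.ncard_singleton g, ⟨fun _ _ => 0, hasSampleComplexity_singleton g, ?_⟩, ?_⟩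
  · intro ε δ hε _ hδ hδ1
    have : 0 ≤ Real.log (1 / δ) := Real.log_nonneg (by rw [le_div_iff₀ hδ]; linarith)
    rw [Nat.cast_zero]
    positivity
  · intro ε hε ℋ H
    have := hg ε hε ℋ H
    push_cast
    exact this
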